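/- **Model.** Two legitimate nodes $1,2$ and an eavesdropper $e$ move in $\mathbb{R}^2$; in slot $i$ their locations are the random points $l_1[i],l_2[i],l_e[i]$, and the law of the triple $(l_1[i],l_2[i],l_e[i])$ is the same in every slot (no further assumption on the dependence between slots or between nodes is made). Let $d_{12},d_{1e},d_{2e}$ be the pairwise distances and $\phi_e\in[0,\pi]$ the angle at $e$ between the directions to nodes $1$ and $2$. Almost surely all distances lie in $[d_{\min},d_{\max}]$, where $d_{\min}>0$. With beacon power $P>0$, the observations in slot $i$ are $$\hat d_j=d_{12}+w_j,\qquad \hat d_{je}=d_{je}+w_{je}\quad(j=1,2),\qquad \hat\phi_e=\phi_e+w_{\phi_e},$$ where, given all locations, the noises are independent (over types and slots), Gaussian with mean $0$ and variances $\gamma(d_{12})\rho_j/P$, $\gamma(d_{je})\rho_e/P$ and $\gamma_\phi(d_{1e},d_{2e})\rho_e/P$ respectively; $\rho_1,\rho_2,\rho_e>0$, and $\gamma$, $\gamma_\phi$ are measurable, and positive and nondecreasing (in each argument) on $[d_{\min},d_{\max}]$. If the eavesdropper makes no angle measurement, $\hat\phi_e$ is replaced by a constant. Over the first $n$ slots let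 $\mathbf{o}_1=(\hat d_1[i])_{i}$, $\mathbf{o}_2=(\hat d_2[i])_{i}$, $\mathbf{o}_e=(\hat d_{1e}[i],\hat d_{2e}[i],\hat\phi_e[i])_{i}$ (no global location information), and let $$R_U(P)=\limsup_{n\to\infty}\frac1n\min\{I(\mathbf{o}_1;\mathbf{o}_2),\,I(\mathbf{o}_1;\mathbf{o}_2\mid\mathbf{o}_e)\},$$ with information measured in nats. **Theorem.** If the eavesdropper obtains angle information, i.e. $I(\hat{\boldsymbol\phi}_e;\boldsymbol\phi_e)>0$ for some number of slots $n$ and some $P>0$, then $\limsup_{P\to\infty}R_U(P)<\infty$. More precisely, $\limsup_{P\to\infty}R_U(P)\le\eta$, where, with $d_{12},d_{1e},d_{2e}$ distributed as in any one slot, $$\begin{aligned}\eta={}&\tfrac12\log\Big\{2\pi\,\mathbb{E}\Big[\tfrac{\rho_e}{d_{12}^2}\Big(\tfrac{d_{12}^2\rho_1}{\rho_e}\gamma(d_{12})+4(d_{1e}+d_{2e})^2\big(\sqrt{\gamma(d_{1e})}+\sqrt{\gamma(d_{2e})}\big)^2\\&+\big(4d_{1e}d_{2e}+64(d_{1e}d_{2e})^2\big)\gamma_\phi(d_{1e},d_{2e})\\&+8(d_{1e}+d_{2e})d_{1e}d_{2e}\big(\sqrt{\gamma(d_{1e})}+\sqrt{\gamma(d_{2e})}\big)\sqrt{\gamma_\phi(d_{1e},d_{2e})}\\&+64(d_{1e}+d_{2e})^2\big(\gamma(d_{1e})+\gamma(d_{2e})\big)\Big)\Big]\Big\}-\tfrac12\,\mathbb{E}\big[\log(2\pi\rho_1\gamma(d_{12}))\big],\end{aligned}$$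 and $\eta$ is finite: both expectations exist and are finite, and the first one is positive. -/

import Mathlib

open MeasureTheory ProbabilityTheory InformationTheory Filter
open scoped ENNReal

noncomputable section

namespace KeyGen

/-- The plane in which the nodes move. -/
abbrev Plane : Type := EuclideanSpace ℝ (Fin 2)

/-- Mutual information `I(X;Y)` (in nats): the Kullback-Leibler divergence of the joint law of
`(X, Y)` from the product of the marginal laws. -/
def mutualInfo {Ω α β : Type*} [MeasurableSpace Ω] [MeasurableSpace α] [MeasurableSpace β]
    (μ : Measure Ω) (X : Ω → α) (Y : Ω → β) : ℝ≥0∞ :=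
  klDiv (μ.map (fun ω => (X ω, Y ω))) ((μ.map X).prod (μ.map Y))

/-- Conditional mutual information `I(X;Y|Z)` (in nats): the Kullback-Leibler divergence of the
joint law of `(Z, X, Y)` from the law with the same `Z`-marginal under which `X` and `Y` are
conditionally independent given `Z`, with their true conditional laws. -/
def condMutualInfo {Ω α β ζ : Type*} [MeasurableSpace Ω]
    [MeasurableSpace α] [StandardBorelSpace α] [Nonempty α]
    [MeasurableSpace β] [StandardBorelSpace β] [Nonempty β] [MeasurableSpace ζ]
    (μ : Measure Ω) [IsFiniteMeasure μ] (X : Ω → α) (Y : Ω → β) (Z : Ω → ζ) : ℝ≥0∞ :=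
  klDiv (μ.map (fun ω => (Z ω, X ω, Y ω)))
    ((μ.map Z).compProd ((condDistrib X Z μ) ×ₖ (condDistrib Y Z μ)))

/-- The five measurements made in each slot: of `d₁₂` by node 1 and by node 2, of `d₁ₑ`, of `d₂ₑ`
and of the angle `φₑ` by the eavesdropper. -/
inductive Channel : Type
  | dist1
  | dist2
  | dist1e
  | dist2e
  | angle

/-- The data of the model with Gaussian observations and no global location information.
Slots are indexed by `ℕ`, and the first `n` slots are those with index in `Fin n`. -/
structure Model (Ω : Type*) where
  /-- location of node 1 -/
  l1 : ℕ → Ω → Plane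
  /-- location of node 2 -/
  l2 : ℕ → Ω → Plane
  /-- location of the eavesdropper -/
  le : ℕ → Ω → Plane
  /-- normalized (unit variance) noise of each measurement in each slot -/
  Z : Channel → ℕ → Ω → ℝ
  /-- distance dependence of the variance of a distance measurement -/
  γ : ℝ → ℝ
  /-- distance dependence of the variance of the angle measurement -/
  γφ : ℝ → ℝ → ℝ
  /-- capability parameter of node 1 -/
  ρ1 : ℝ
  /-- capability parameter of node 2 -/
  ρ2 : ℝ
  /-- capability parameter of the eavesdropper -/
  ρe : ℝ
  /-- minimal distance -/
  dMin : ℝ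
  /-- maximal distance -/
  dMax : ℝ
  /-- whether the eavesdropper makes an angle measurement at all -/
  observesAngle : Bool

namespace Model

variable {Ω : Type*} (M : Model Ω)

/-- Distance between the legitimate nodes in slot `i`. -/
def d12 (i : ℕ) (ω : Ω) : ℝ := dist (M.l1 i ω) (M.l2 i ω)

/-- Distance between node 1 and the eavesdropper in slot `i`. -/
def d1e (i : ℕ) (ω : Ω) : ℝ := dist (M.l1 i ω) (M.le i ω)

/-- Distance between node 2 and the eavesdropper in slot `i`. -/
def d2e (i : ℕ) (ω : Ω) : ℝ := dist (M.l2 i ω) (M.le i ω)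

/-- The angle between the legitimate nodes as seen from the eavesdropper, i.e. the angle at the
vertex `e` of the triangle `1, e, 2`, in `[0, π]`. -/
def phi (i : ℕ) (ω : Ω) : ℝ := EuclideanGeometry.angle (M.l1 i ω) (M.le i ω) (M.l2 i ω)

/-- Locations of the three nodes in slot `i`. -/
def state (i : ℕ) (ω : Ω) : Plane × Plane × Plane := (M.l1 i ω, M.l2 i ω, M.le i ω)

/-- Observation of `d₁₂` by node 1 at beacon power `P`: given the locations, the noise is
Gaussian with mean `0` and variance `γ(d₁₂) ρ₁ / P`. -/
def dhat1 (P : ℝ) (i : ℕ) (ω : Ω) : ℝ :=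
  M.d12 i ω + √(M.γ (M.d12 i ω) * M.ρ1 / P) * M.Z .dist1 i ω

/-- Observation of `d₁₂` by node 2, with noise variance `γ(d₁₂) ρ₂ / P`. -/
def dhat2 (P : ℝ) (i : ℕ) (ω : Ω) : ℝ :=
  M.d12 i ω + √(M.γ (M.d12 i ω) * M.ρ2 / P) * M.Z .dist2 i ω

/-- Observation of `d₁ₑ` by the eavesdropper, with noise variance `γ(d₁ₑ) ρₑ / P`. -/
def dhat1e (P : ℝ) (i : ℕ) (ω : Ω) : ℝ :=
  M.d1e i ω + √(M.γ (M.d1e i ω) * M.ρe / P) * M.Z .dist1e i ω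

/-- Observation of `d₂ₑ` by the eavesdropper, with noise variance `γ(d₂ₑ) ρₑ / P`. -/
def dhat2e (P : ℝ) (i : ℕ) (ω : Ω) : ℝ :=
  M.d2e i ω + √(M.γ (M.d2e i ω) * M.ρe / P) * M.Z .dist2e i ω

/-- Observation of `φₑ` by the eavesdropper, with noise variance `γφ(d₁ₑ, d₂ₑ) ρₑ / P`. If the
eavesdropper makes no angle measurement, this is a constant, which carries no information. -/
def phihat (P : ℝ) (i : ℕ) (ω : Ω) : ℝ :=
  if M.observesAngle then
    M.phi i ω + √(M.γφ (M.d1e i ω) (M.d2e i ω) * M.ρe / P) * M.Z .angle i ω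
  else 0

/-- Observations of node 1 in the first `n` slots. -/
def obs1 (P : ℝ) (n : ℕ) (ω : Ω) : Fin n → ℝ := fun i => M.dhat1 P i ω

/-- Observations of node 2 in the first `n` slots. -/
def obs2 (P : ℝ) (n : ℕ) (ω : Ω) : Fin n → ℝ := fun i => M.dhat2 P i ω

/-- Observations of the eavesdropper in the first `n` slots. -/
def obsE (P : ℝ) (n : ℕ) (ω : Ω) : Fin n → ℝ × ℝ × ℝ :=
  fun i => (M.dhat1e P i ω, M.dhat2e P i ω, M.phihat P i ω)

/-- The angles in the first `n` slots. -/
def phiVec (n : ℕ) (ω : Ω) : Fin n → ℝ := fun i => M.phi i ω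

/-- The angle observations in the first `n` slots. -/
def phihatVec (P : ℝ) (n : ℕ) (ω : Ω) : Fin n → ℝ := fun i => M.phihat P i ω

variable [MeasurableSpace Ω] (μ : Measure Ω)

/-- The assumptions of the model. -/
structure IsGaussian : Prop where
  meas_l1 : ∀ i, Measurable (M.l1 i)
  meas_l2 : ∀ i, Measurable (M.l2 i)
  meas_le : ∀ i, Measurable (M.le i)
  /-- the triple of locations has the same distribution in every slot -/
  stationary : ∀ i, μ.map (M.state i) = μ.map (M.state 0)
  dMin_pos : 0 < M.dMin
  d12_mem : ∀ i, ∀ᵐ ω ∂μ, M.d12 i ω ∈ Set.Icc M.dMin M.dMax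
  d1e_mem : ∀ i, ∀ᵐ ω ∂μ, M.d1e i ω ∈ Set.Icc M.dMin M.dMax
  d2e_mem : ∀ i, ∀ᵐ ω ∂μ, M.d2e i ω ∈ Set.Icc M.dMin M.dMax
  meas_γ : Measurable M.γ
  mono_γ : MonotoneOn M.γ (Set.Icc M.dMin M.dMax)
  γ_pos : ∀ x ∈ Set.Icc M.dMin M.dMax, 0 < M.γ x
  meas_γφ : Measurable (Function.uncurry M.γφ)
  mono_γφ : MonotoneOn (Function.uncurry M.γφ)
    (Set.Icc M.dMin M.dMax ×ˢ Set.Icc M.dMin M.dMax)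
  γφ_pos : ∀ x ∈ Set.Icc M.dMin M.dMax, ∀ y ∈ Set.Icc M.dMin M.dMax, 0 < M.γφ x y
  ρ1_pos : 0 < M.ρ1
  ρ2_pos : 0 < M.ρ2
  ρe_pos : 0 < M.ρe
  meas_Z : ∀ c i, Measurable (M.Z c i)
  /-- the normalized noises are standard Gaussian, -/
  law_Z : ∀ c i, μ.map (M.Z c i) = gaussianReal 0 1
  /-- independent across measurements and slots, -/
  indep_Z : iIndepFun (fun (k : Channel × ℕ) => M.Z k.1 k.2) μ
  /-- and jointly independent of the movement of the nodes -/
  indep_state : IndepFun (fun ω (i : ℕ) => M.state i ω)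
    (fun ω (k : Channel × ℕ) => M.Z k.1 k.2 ω) μ

/-- The upper bound `R_U` on the key rate at beacon power `P`: the limit over `n` of
`min {I(o₁;o₂), I(o₁;o₂|oₑ)} / n`. The upper limit is used, so that no existence of the limit has
to be presupposed. -/
def RU [IsFiniteMeasure μ] (P : ℝ) : ℝ≥0∞ :=
  limsup (fun n : ℕ =>
    min (mutualInfo μ (M.obs1 P n) (M.obs2 P n))
      (condMutualInfo μ (M.obs1 P n) (M.obs2 P n) (M.obsE P n)) / (n : ℝ≥0∞)) atTop

/-- The quantity whose expectation stands inside the first logarithm in `η`. -/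
def etaInner (ω : Ω) : ℝ :=
  M.ρe / M.d12 0 ω ^ 2 *
    (M.d12 0 ω ^ 2 * M.ρ1 / M.ρe * M.γ (M.d12 0 ω)
      + 4 * (M.d1e 0 ω + M.d2e 0 ω) ^ 2 * (√(M.γ (M.d1e 0 ω)) + √(M.γ (M.d2e 0 ω))) ^ 2
      + (4 * (M.d1e 0 ω * M.d2e 0 ω) + 64 * (M.d1e 0 ω * M.d2e 0 ω) ^ 2)
          * M.γφ (M.d1e 0 ω) (M.d2e 0 ω)
      + 8 * (M.d1e 0 ω + M.d2e 0 ω) * (M.d1e 0 ω * M.d2e 0 ω)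
          * (√(M.γ (M.d1e 0 ω)) + √(M.γ (M.d2e 0 ω))) * √(M.γφ (M.d1e 0 ω) (M.d2e 0 ω))
      + 64 * (M.d1e 0 ω + M.d2e 0 ω) ^ 2 * (M.γ (M.d1e 0 ω) + M.γ (M.d2e 0 ω)))

/-- The logarithm whose expectation is the second term of `η`. -/
def etaLog (ω : Ω) : ℝ := Real.log (2 * Real.pi * M.ρ1 * M.γ (M.d12 0 ω))

/-- The explicit bound `η`. -/
def eta : ℝ :=
  1 / 2 * Real.log (2 * Real.pi * ∫ ω, M.etaInner ω ∂μ) - 1 / 2 * ∫ ω, M.etaLog ω ∂μ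

end Model

end KeyGen

end

/-! The eavesdropper can nearly reproduce node 1's observation: two sides of a triangle and the
enclosed angle determine the third side, so the law of cosines applied to her noisy data estimates
`d12` with mean square error O(1/P). Node 1's own noise variance is also of order 1/P.
Heuristically, with `T` all randomness except node 1's noise, I(o₁;o₂|oₑ) ≤ I(o₁;T|oₑ) = h(o₁|oₑ) -
h(o₁|T). The last entropy is that of Gaussian noise, the other is at most that of a Gaussian with
the variance of the estimation error, and log P cancels in the difference.

The proof avoids differential entropies. `condMutualInfo_le_klDiv_prod` bounds I(X;Y|Z) by a
divergence from a law in which X given Z may be chosen freely; the choice is a Gaussian centred at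
the estimate, and `klDiv_map_add_mul_gaussian` evaluates the divergence. This gives
`condMutualInfo_le_of_gaussian_noise`. The error is controlled by `sq_thirdSide_sub_le` and
`le_errorBound`, whose slack absorbs the generous constants of η. The resulting bound nη holds for
every P > 0 and every n, so both limits are immediate. -/

namespace KeyGen

/-! ### Variational bounds on conditional mutual information. -/

section CondMutualInfo

variable {Ω α β ζ τ υ : Type*} [MeasurableSpace Ω]
  [MeasurableSpace α] [StandardBorelSpace α] [Nonempty α]
  [MeasurableSpace β] [StandardBorelSpace β] [Nonempty β] [MeasurableSpace ζ]
  [MeasurableSpace τ] [MeasurableSpace υ]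

/-- `I(X;Y|Z)` is at most the divergence of the joint law from the law under which `X` and `Y` are
conditionally independent given `Z` and `X` follows an arbitrary kernel `Q`. -/
lemma condMutualInfo_le_klDiv_compProd (μ : Measure Ω) [IsProbabilityMeasure μ]
    {X : Ω → α} {Y : Ω → β} {Z : Ω → ζ} (hX : Measurable X) (hY : Measurable Y)
    (hZ : Measurable Z) (Q : Kernel ζ α) [IsMarkovKernel Q] :
    condMutualInfo μ X Y Z ≤ klDiv (μ.map (fun ω => ((Z ω, X ω), Y ω)))
      ((μ.map Z ⊗ₘ Q) ⊗ₘ (condDistrib Y Z μ).prodMkRight α) := by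
  have hpZ : IsProbabilityMeasure (μ.map Z) := Measure.isProbabilityMeasure_map hZ.aemeasurable
  set η := (condDistrib Y Z μ).prodMkRight α with hη
  have hZX : Measurable (fun ω => (Z ω, X ω)) := hZ.prodMk hX
  have hpZX : IsProbabilityMeasure (μ.map (fun ω => (Z ω, X ω))) :=
    Measure.isProbabilityMeasure_map hZX.aemeasurable
  set m := μ.map (fun ω => (Z ω, X ω)) with hm
  set κ := condDistrib Y (fun ω => (Z ω, X ω)) μ with hκ
  have h1 : m ⊗ₘ κ = μ.map (fun ω => ((Z ω, X ω), Y ω)) :=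
    compProd_map_condDistrib hY.aemeasurable
  have h2 : μ.map Z ⊗ₘ condDistrib X Z μ = m := compProd_map_condDistrib hX.aemeasurable
  have hj : μ.map (fun ω => (Z ω, X ω, Y ω)) =
      (m ⊗ₘ κ).map (fun p : (ζ × α) × β => (p.1.1, p.1.2, p.2)) := by
    rw [h1, Measure.map_map (by fun_prop) (by fun_prop)]
    rfl
  have hr : (μ.map Z).compProd ((condDistrib X Z μ) ×ₖ (condDistrib Y Z μ)) =
      (m ⊗ₘ η).map (fun p : (ζ × α) × β => (p.1.1, p.1.2, p.2)) := by
    refine Measure.ext_of_lintegral _ fun F hF => ?_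
    rw [lintegral_map hF (by fun_prop), Measure.lintegral_compProd hF,
      Measure.lintegral_compProd (by fun_prop), ← h2,
      Measure.lintegral_compProd (f := fun a : ζ × α => ∫⁻ b, F (a.1, a.2, b) ∂η a)
        (Measurable.lintegral_kernel_prod_right'
          (f := fun p : (ζ × α) × β => F (p.1.1, p.1.2, p.2)) (by fun_prop))]
    refine lintegral_congr fun z => ?_
    rw [Kernel.prod_apply, lintegral_prod _ (by fun_prop)]
    simp [hη]
  rw [condMutualInfo, hj, hr, ← h1]
  refine (klDiv_map_le _ _ (by fun_prop)).trans ?_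
  -- Chain rule: the divergence is that of the laws of (Z, X) plus the conditional one of Y given
  -- (Z, X). The second summand is I(X;Y|Z) up to reassociation; the first, the price of using `Q`
  -- instead of the true conditional law, is dropped.
  rw [klDiv_compProd_eq_add m (μ.map Z ⊗ₘ Q) κ η]
  exact le_add_self

/-- If `(Y, Z)` is a function of `T` and `X` is a function of `(Z, U)`, then `I(X;Y|Z)` is bounded
by the divergence of the law of `(T, U)` from the product of the law of `T` and any law `ν`. -/
lemma condMutualInfo_le_klDiv_prod (μ : Measure Ω) [IsProbabilityMeasure μ]
    {X : Ω → α} {Y : Ω → β} {Z : Ω → ζ} {T : Ω → τ} {U : Ω → υ} {f : τ → β} {g : τ → ζ}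
    {Φ : ζ × υ → α} (hX : Measurable X) (hT : Measurable T) (hU : Measurable U)
    (hf : Measurable f) (hg : Measurable g) (hΦ : Measurable Φ)
    (hYT : ∀ ω, Y ω = f (T ω)) (hZT : ∀ ω, Z ω = g (T ω)) (hXU : ∀ ω, X ω = Φ (Z ω, U ω))
    (ν : Measure υ) [IsProbabilityMeasure ν] :
    condMutualInfo μ X Y Z ≤ klDiv (μ.map (fun ω => (T ω, U ω))) ((μ.map T).prod ν) := by
  have hY : Measurable Y := by rw [funext hYT]; fun_prop
  have hZ : Measurable Z := by rw [funext hZT]; fun_prop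
  have hpT : IsProbabilityMeasure (μ.map T) := Measure.isProbabilityMeasure_map hT.aemeasurable
  have hpZ : IsProbabilityMeasure (μ.map Z) := Measure.isProbabilityMeasure_map hZ.aemeasurable
  -- The law of `Φ (z, u)` for `u` drawn from `ν`: what X would be if U had law `ν` and were
  -- independent of T.
  set Q : Kernel ζ α := (Kernel.id ×ₖ Kernel.const ζ ν).map Φ with hQ
  have hQm : IsMarkovKernel Q := Kernel.IsMarkovKernel.map _ hΦ
  have hQF (z : ζ) (F : α → ℝ≥0∞) (hF : Measurable F) :
      ∫⁻ x, F x ∂(Q z) = ∫⁻ u, F (Φ (z, u)) ∂ν := by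
    rw [hQ, Kernel.map_apply _ hΦ, lintegral_map hF hΦ, Kernel.prod_apply,
      lintegral_prod _ (by fun_prop)]
    simp only [Kernel.id_apply, Kernel.const_apply]
    rw [lintegral_dirac' _ (Measurable.lintegral_prod_right (by fun_prop))]
  set G : τ × υ → (ζ × α) × β := fun p => ((g p.1, Φ (g p.1, p.2)), f p.1) with hGd
  have hG : Measurable G := by fun_prop
  have h1 : μ.map (fun ω => ((Z ω, X ω), Y ω)) = (μ.map (fun ω => (T ω, U ω))).map G := by
    rw [Measure.map_map hG (by fun_prop)]
    congr 1
    ext ω : 1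
    simp [hGd, hYT, hZT, hXU]
  -- Under the product law `u` is independent of (Y, Z), so X and Y are conditionally independent
  -- given Z. With this, both laws are images under the same map `G`, and data processing applies.
  have h2 : (μ.map Z ⊗ₘ Q) ⊗ₘ (condDistrib Y Z μ).prodMkRight α =
      ((μ.map T).prod ν).map G := by
    have h3 : μ.map Z ⊗ₘ condDistrib Y Z μ = μ.map (fun ω => (Z ω, Y ω)) :=
      compProd_map_condDistrib hY.aemeasurable
    refine Measure.ext_of_lintegral _ fun F hF => ?_
    rw [lintegral_map hF hG, lintegral_prod _ (by fun_prop), Measure.lintegral_compProd hF,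
      Measure.lintegral_compProd (Measurable.lintegral_kernel_prod_right' hF)]
    calc ∫⁻ z, ∫⁻ x, ∫⁻ y, F ((z, x), y) ∂((condDistrib Y Z μ).prodMkRight α (z, x)) ∂(Q z)
          ∂(μ.map Z)
        = ∫⁻ z, ∫⁻ y, ∫⁻ u, F ((z, Φ (z, u)), y) ∂ν ∂(condDistrib Y Z μ z) ∂(μ.map Z) := by
          refine lintegral_congr fun z => ?_
          simp only [Kernel.prodMkRight_apply]
          rw [hQF z (fun x => ∫⁻ y, F ((z, x), y) ∂(condDistrib Y Z μ z))
            (Measurable.lintegral_prod_right (by fun_prop))]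
          exact lintegral_lintegral_swap (by fun_prop)
      _ = ∫⁻ p, ∫⁻ u, F ((p.1, Φ (p.1, u)), p.2) ∂ν ∂(μ.map Z ⊗ₘ condDistrib Y Z μ) := by
          rw [Measure.lintegral_compProd (Measurable.lintegral_prod_right (by fun_prop))]
      _ = _ := by
          rw [h3, lintegral_map (Measurable.lintegral_prod_right (by fun_prop)) (by fun_prop),
            lintegral_map (Measurable.lintegral_prod_right (by fun_prop)) hT]
          simp [hGd, hYT, hZT]
  refine (condMutualInfo_le_klDiv_compProd μ hX hY hZ Q).trans ?_
  rw [h1, h2]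
  exact klDiv_map_le _ _ hG

end CondMutualInfo

/-! ### Densities relative to the standard Gaussian measure. -/

section Gaussian

/-- It suffices to compare on boxes. There the density cut off by the indicator is a product of
functions of single coordinates, which are independent under the product measure, so its integral
factors. -/
lemma pi_withDensity {ι : Type*} [Fintype ι] {α : ι → Type*} [∀ i, MeasurableSpace (α i)]
    (ν : ∀ i, Measure (α i)) [∀ i, IsProbabilityMeasure (ν i)] {f : ∀ i, α i → ℝ≥0∞}
    (hf : ∀ i, Measurable (f i)) [∀ i, SigmaFinite ((ν i).withDensity (f i))] :
    Measure.pi (fun i => (ν i).withDensity (f i)) =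
      (Measure.pi ν).withDensity (fun x => ∏ i, f i (x i)) := by
  refine Measure.pi_eq fun s hs => ?_
  have hi (i) : Measurable ((s i).indicator (f i)) := (hf i).indicator (hs i)
  have hind : iIndepFun (fun i (x : ∀ i, α i) => (s i).indicator (f i) (x i)) (Measure.pi ν) :=
    iIndepFun_pi fun i => (hi i).aemeasurable
  have hsm : MeasurableSet (Set.univ.pi s) := MeasurableSet.univ_pi hs
  rw [withDensity_apply _ hsm, ← lintegral_indicator hsm]
  have h1 : (Set.univ.pi s).indicator (fun x : ∀ i, α i => ∏ i, f i (x i)) =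
      fun x => ∏ i, (s i).indicator (f i) (x i) := by
    ext x
    classical
    by_cases hx : x ∈ Set.univ.pi s
    · rw [Set.indicator_of_mem hx]
      exact Finset.prod_congr rfl fun i _ => (Set.indicator_of_mem (hx i trivial) _).symm
    · rw [Set.indicator_of_notMem hx]
      simp only [Set.mem_pi, Set.mem_univ, true_imp_iff, not_forall] at hx
      obtain ⟨i, hxi⟩ := hx
      exact (Finset.prod_eq_zero (Finset.mem_univ i) (Set.indicator_of_notMem hxi _)).symm
  rw [h1, lintegral_prod_eq_prod_lintegral_of_indepFun _ _ hind
    fun i => (hi i).comp (measurable_pi_apply i)]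
  refine Finset.prod_congr rfl fun i _ => ?_
  rw [withDensity_apply _ (hs i), ← lintegral_indicator (hs i),
    ← (measurePreserving_eval ν i).map_eq, lintegral_map (hi i) (measurable_pi_apply i)]

/-- Log-density of the law of `a + b N` relative to that of `N`, for a standard Gaussian `N`. -/
noncomputable def logGaussRatio (a b u : ℝ) : ℝ := u ^ 2 / 2 - (u - a) ^ 2 / (2 * b ^ 2) - Real.log b

@[fun_prop]
lemma measurable_logGaussRatio {τ : Type*} [MeasurableSpace τ] {f g h : τ → ℝ} (hf : Measurable f)
    (hg : Measurable g) (hh : Measurable h) :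
    Measurable (fun t => logGaussRatio (f t) (g t) (h t)) := by
  unfold logGaussRatio
  fun_prop

lemma map_gaussianReal_eq_withDensity (a : ℝ) {b : ℝ} (hb : 0 < b) :
    (gaussianReal 0 1).map (fun x => a + b * x) =
      (gaussianReal 0 1).withDensity
        (fun u => ENNReal.ofReal (Real.exp (logGaussRatio a b u))) := by
  have h1 : (gaussianReal 0 1).map (fun x => a + b * x) =
      gaussianReal a (.mk (b ^ 2) (sq_nonneg _)) := by
    have : (fun x => a + b * x) = (fun x => a + x) ∘ (fun x => b * x) := rfl
    rw [this, ← Measure.map_map (by fun_prop) (by fun_prop), gaussianReal_map_const_mul,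
      gaussianReal_map_const_add]
    simp
  have hb2 : (.mk (b ^ 2) (sq_nonneg _) : NNReal) ≠ 0 := by
    intro h
    have := congrArg NNReal.toReal h
    simp at this
    exact hb.ne' this
  have hm : Measurable (fun u => ENNReal.ofReal (Real.exp (logGaussRatio a b u))) := by
    fun_prop
  rw [h1, gaussianReal_of_var_ne_zero _ hb2, gaussianReal_of_var_ne_zero _ one_ne_zero,
    ← withDensity_mul _ (measurable_gaussianPDF _ _) hm]
  congr 1
  ext u
  simp only [Pi.mul_apply, gaussianPDF, gaussianPDFReal, logGaussRatio]
  rw [← ENNReal.ofReal_mul (by positivity)]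
  congr 1
  rw [Real.exp_sub, Real.exp_log hb, ← mul_div_assoc, mul_assoc _ (Real.exp _) (Real.exp _),
    ← Real.exp_add]
  simp only [NNReal.coe_mk, NNReal.coe_one, sub_zero, mul_one]
  rw [Real.sqrt_mul (by positivity), Real.sqrt_sq hb.le]
  have : -u ^ 2 / 2 + (u ^ 2 / 2 - (u - a) ^ 2 / (2 * b ^ 2)) = -(u - a) ^ 2 / (2 * b ^ 2) := by
    ring
  rw [this]
  field_simp

end Gaussian

end KeyGen

namespace KeyGen

/-! ### Divergence and information bounds for a Gaussian channel with random mean and scale. -/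

section GaussianChannel

variable {Ω τ : Type*} [MeasurableSpace Ω] [MeasurableSpace τ] {n : ℕ}

/-- Since N is independent of T, fixing T = t freezes the means and scales and leaves a product of
one-dimensional Gaussians; Fubini glues the fibrewise densities. -/
lemma map_add_mul_gaussian_eq_withDensity (μ : Measure Ω) [IsProbabilityMeasure μ]
    {T : Ω → τ} {N U : Ω → Fin n → ℝ} (hT : Measurable T) (hN : Measurable N)
    (hTN : IndepFun T N μ) (hlaw : μ.map N = Measure.pi (fun _ => gaussianReal 0 1))
    {a b : Fin n → τ → ℝ} (ha : ∀ i, Measurable (a i)) (hb : ∀ i, Measurable (b i))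
    (hb0 : ∀ i t, 0 < b i t) (hUN : ∀ᵐ ω ∂μ, ∀ i, U ω i = a i (T ω) + b i (T ω) * N ω i) :
    μ.map (fun ω => (T ω, U ω)) =
      ((μ.map T).prod (Measure.pi (fun _ : Fin n => gaussianReal 0 1))).withDensity
        (fun p => ENNReal.ofReal (Real.exp
          (∑ i, logGaussRatio (a i p.1) (b i p.1) (p.2 i)))) := by
  have hpT : IsProbabilityMeasure (μ.map T) := Measure.isProbabilityMeasure_map hT.aemeasurable
  set γ := Measure.pi (fun _ : Fin n => gaussianReal 0 1) with hγ
  set r : τ × (Fin n → ℝ) → ℝ≥0∞ := fun p => ENNReal.ofReal (Real.exp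
          (∑ i, logGaussRatio (a i p.1) (b i p.1) (p.2 i))) with hr
  have hrm : Measurable r := by
    unfold r
    fun_prop
  have hS : Measurable (fun p : τ × (Fin n → ℝ) => (p.1, fun i => a i p.1 + b i p.1 * p.2 i)) := by
    fun_prop
  have h1 : μ.map (fun ω => (T ω, U ω)) =
      ((μ.map T).prod γ).map (fun p => (p.1, fun i => a i p.1 + b i p.1 * p.2 i)) := by
    rw [← hlaw, ← hTN.map_prod_eq_prod_map_map hT.aemeasurable hN.aemeasurable,
      Measure.map_map hS (hT.prodMk hN)]
    refine Measure.map_congr ?_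
    filter_upwards [hUN] with ω hω
    exact Prod.ext rfl (funext hω)
  have hpush (t : τ) : γ.map (fun x i => a i t + b i t * x i) =
      γ.withDensity (fun u => r (t, u)) := by
    have h2 (i : Fin n) := map_gaussianReal_eq_withDensity (a i t) (hb0 i t)
    have hsf (i : Fin n) : IsProbabilityMeasure ((gaussianReal 0 1).withDensity
        (fun u => ENNReal.ofReal (Real.exp (logGaussRatio (a i t) (b i t) u)))) := by
      rw [← h2 i]
      exact Measure.isProbabilityMeasure_map (by fun_prop)
    have hfm (i : Fin n) : Measurable
        (fun u => ENNReal.ofReal (Real.exp (logGaussRatio (a i t) (b i t) u))) := by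
      fun_prop
    have hsf' (i : Fin n) :
        IsProbabilityMeasure ((gaussianReal 0 1).map (fun x => a i t + b i t * x)) :=
      Measure.isProbabilityMeasure_map (by fun_prop)
    rw [hγ, Measure.pi_map_pi (f := fun i x => a i t + b i t * x) (by fun_prop)]
    simp_rw [h2]
    rw [pi_withDensity _ hfm]
    congr 1
    ext u
    rw [hr]
    simp only
    rw [Real.exp_sum, ENNReal.ofReal_prod_of_nonneg fun i _ => (Real.exp_pos _).le]
  rw [h1]
  refine Measure.ext_of_lintegral _ fun F hF => ?_
  rw [lintegral_map hF hS, lintegral_prod _ (by fun_prop),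
    lintegral_withDensity_eq_lintegral_mul _ hrm hF, lintegral_prod _ (by fun_prop)]
  refine lintegral_congr fun t => ?_
  have h3 := lintegral_map (μ := γ) (f := fun u => F (t, u))
    (g := fun x i => a i t + b i t * x i) (by fun_prop) (by fun_prop)
  simp only at h3 ⊢
  rw [← h3, hpush, lintegral_withDensity_eq_lintegral_mul _ (by fun_prop) (by fun_prop)]
  rfl

lemma integrable_sq_gaussian {Ω : Type*} [MeasurableSpace Ω] {μ : Measure Ω} {N : Ω → ℝ}
    (hN : Measurable N) (hlaw : μ.map N = gaussianReal 0 1) :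
    Integrable (fun ω => N ω ^ 2) μ := by
  have h : MemLp id 2 (gaussianReal 0 1) := memLp_id_gaussianReal' 2 (by simp)
  rw [← hlaw] at h
  exact ((memLp_map_measure_iff aestronglyMeasurable_id hN.aemeasurable).1 h).integrable_sq

lemma integral_sq_gaussian {Ω : Type*} [MeasurableSpace Ω] {μ : Measure Ω} {N : Ω → ℝ}
    (hN : Measurable N) (hlaw : μ.map N = gaussianReal 0 1) :
    ∫ ω, N ω ^ 2 ∂μ = 1 := by
  have h := variance_fun_id_gaussianReal (μ := 0) (v := 1)
  rw [variance_eq_integral measurable_id'.aemeasurable] at h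
  simp only [integral_id_gaussianReal, sub_zero, NNReal.coe_one] at h
  rw [← hlaw, integral_map hN.aemeasurable (by fun_prop)] at h
  exact h

/-- The divergence of the law of `(T, a(T) + b(T) N)` from that of `(T, N)`, where `N` is a standard
Gaussian vector independent of `T`. -/
lemma klDiv_map_add_mul_gaussian (μ : Measure Ω) [IsProbabilityMeasure μ]
    {T : Ω → τ} {N U : Ω → Fin n → ℝ} (hT : Measurable T) (hN : Measurable N) (hU : Measurable U)
    (hTN : IndepFun T N μ) (hlaw : μ.map N = Measure.pi (fun _ => gaussianReal 0 1))
    {a b : Fin n → τ → ℝ} (ha : ∀ i, Measurable (a i)) (hb : ∀ i, Measurable (b i))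
    (hb0 : ∀ i t, 0 < b i t) (hUN : ∀ᵐ ω ∂μ, ∀ i, U ω i = a i (T ω) + b i (T ω) * N ω i)
    (hlog : ∀ i, Integrable (fun ω => Real.log (b i (T ω))) μ)
    (hU2 : ∀ i, Integrable (fun ω => U ω i ^ 2) μ) :
    0 ≤ ∑ i, ((∫ ω, U ω i ^ 2 ∂μ) / 2 - 1 / 2 - ∫ ω, Real.log (b i (T ω)) ∂μ) ∧
    klDiv (μ.map (fun ω => (T ω, U ω)))
        ((μ.map T).prod (Measure.pi (fun _ : Fin n => gaussianReal 0 1))) =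
      ENNReal.ofReal (∑ i, ((∫ ω, U ω i ^ 2 ∂μ) / 2 - 1 / 2 - ∫ ω, Real.log (b i (T ω)) ∂μ)) := by
  have hpT : IsProbabilityMeasure (μ.map T) := Measure.isProbabilityMeasure_map hT.aemeasurable
  have hTU : Measurable (fun ω => (T ω, U ω)) := hT.prodMk hU
  have hd := map_add_mul_gaussian_eq_withDensity μ hT hN hTN hlaw ha hb hb0 hUN
  set J := μ.map (fun ω => (T ω, U ω)) with hJ
  set R := (μ.map T).prod (Measure.pi (fun _ : Fin n => gaussianReal 0 1)) with hR
  have hpJ : IsProbabilityMeasure J := Measure.isProbabilityMeasure_map hTU.aemeasurable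
  set l : τ × (Fin n → ℝ) → ℝ := fun p => ∑ i, logGaussRatio (a i p.1) (b i p.1) (p.2 i) with hl
  have hlm : Measurable l := by
    unfold l
    fun_prop
  have hac : J ≪ R := by
    rw [hd]
    exact withDensity_absolutelyContinuous _ _
  have hllr : llr J R =ᵐ[J] l := by
    have h1 : J.rnDeriv R =ᵐ[R] fun p => ENNReal.ofReal (Real.exp (l p)) := by
      rw [hd]
      exact Measure.rnDeriv_withDensity _ (by fun_prop)
    filter_upwards [hac.ae_le h1] with p hp
    simp only [llr_def]
    rw [hp, ENNReal.toReal_ofReal (Real.exp_pos _).le, Real.log_exp]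
  have hlawi (i : Fin n) : μ.map (fun ω => N ω i) = gaussianReal 0 1 := by
    have h1 := (measurePreserving_eval (fun _ : Fin n => gaussianReal 0 1) i).map_eq
    rw [← hlaw, Measure.map_map (measurable_pi_apply i) hN] at h1
    exact h1
  have hNi (i : Fin n) : Measurable (fun ω => N ω i) := (measurable_pi_apply i).comp hN
  -- Along the actual data (U - a) / b is N. The unknown mean thus disappears from the log-density,
  -- and only the second moment of U and the mean of log b matter.
  have hlT : (fun ω => l (T ω, U ω)) =ᵐ[μ]
      fun ω => ∑ i, (U ω i ^ 2 / 2 - N ω i ^ 2 / 2 - Real.log (b i (T ω))) := by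
    filter_upwards [hUN] with ω hω
    simp only [hl, logGaussRatio]
    refine Finset.sum_congr rfl fun i _ => ?_
    have h2 : U ω i - a i (T ω) = b i (T ω) * N ω i := by rw [hω i]; ring
    have h3 := (hb0 i (T ω)).ne'
    rw [h2, mul_pow]
    field_simp
  have hint1 (i : Fin n) : Integrable (fun ω => U ω i ^ 2 / 2 - N ω i ^ 2 / 2) μ :=
    ((hU2 i).div_const 2).sub ((integrable_sq_gaussian (hNi i) (hlawi i)).div_const 2)
  have hint (i : Fin n) : Integrable
      (fun ω => U ω i ^ 2 / 2 - N ω i ^ 2 / 2 - Real.log (b i (T ω))) μ := (hint1 i).sub (hlog i)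
  have hlint : Integrable l J := by
    rw [hJ, integrable_map_measure hlm.aestronglyMeasurable hTU.aemeasurable]
    exact (integrable_finsetSum _ fun i _ => hint i).congr hlT.symm
  have hval : ∫ p, llr J R p ∂J =
      ∑ i, ((∫ ω, U ω i ^ 2 ∂μ) / 2 - 1 / 2 - ∫ ω, Real.log (b i (T ω)) ∂μ) := by
    rw [integral_congr_ae hllr, hJ, integral_map hTU.aemeasurable hlm.aestronglyMeasurable,
      integral_congr_ae hlT, integral_finsetSum _ fun i _ => hint i]
    refine Finset.sum_congr rfl fun i _ => ?_
    rw [integral_sub (hint1 i) (hlog i), integral_sub ((hU2 i).div_const 2)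
      ((integrable_sq_gaussian (hNi i) (hlawi i)).div_const 2), integral_div, integral_div,
      integral_sq_gaussian (hNi i) (hlawi i)]
  have hli : Integrable (llr J R) J := hlint.congr hllr.symm
  -- Nonnegativity of the real expression shows that `ENNReal.ofReal` truncates nothing; it later
  -- yields that η is nonnegative.
  have hnn := integral_llr_add_sub_measure_univ_nonneg hac hli
  rw [hval] at hnn
  refine ⟨by simpa using hnn, ?_⟩
  rw [klDiv_of_ac_of_integrable hac hli, hval]
  simp

/-- A bound on `I(X;Y|Z)` for a Gaussian channel `X = m(T) + s(T) N`, in terms of the mean square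
error of any estimator of `X` from `Z`. -/
theorem condMutualInfo_le_of_gaussian_noise {β ζ : Type*}
    [MeasurableSpace β] [StandardBorelSpace β] [Nonempty β] [MeasurableSpace ζ]
    (μ : Measure Ω) [IsProbabilityMeasure μ]
    {T : Ω → τ} {X N : Ω → Fin n → ℝ} {Y : Ω → β} {Z : Ω → ζ} {f : τ → β} {g : τ → ζ}
    (hT : Measurable T) (hN : Measurable N) (hX : Measurable X) (hf : Measurable f)
    (hg : Measurable g) (hYT : ∀ ω, Y ω = f (T ω)) (hZT : ∀ ω, Z ω = g (T ω))
    (hTN : IndepFun T N μ) (hlaw : μ.map N = Measure.pi (fun _ => gaussianReal 0 1))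
    {m s : Fin n → τ → ℝ} (hm : ∀ i, Measurable (m i)) (hs : ∀ i, Measurable (s i))
    (hs0 : ∀ i t, 0 < s i t) (hXN : ∀ᵐ ω ∂μ, ∀ i, X ω i = m i (T ω) + s i (T ω) * N ω i)
    (hlog : ∀ i, Integrable (fun ω => Real.log (s i (T ω))) μ)
    {e : Fin n → ζ → ℝ} (he : ∀ i, Measurable (e i)) {σ : ℝ} (hσ : 0 < σ)
    (hint : ∀ i, Integrable (fun ω => (X ω i - e i (Z ω)) ^ 2) μ)
    (hmse : ∀ i, ∫ ω, (X ω i - e i (Z ω)) ^ 2 ∂μ ≤ σ ^ 2) :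
    0 ≤ ∑ i, (Real.log σ - ∫ ω, Real.log (s i (T ω)) ∂μ) ∧
    condMutualInfo μ X Y Z ≤
      ENNReal.ofReal (∑ i, (Real.log σ - ∫ ω, Real.log (s i (T ω)) ∂μ)) := by
  have hZ : Measurable Z := by rw [funext hZT]; fun_prop
  -- The estimation error in units of σ. Comparing it with a standard Gaussian amounts to the
  -- reference law N(e(Z), σ²) for X given Z.
  set U : Ω → Fin n → ℝ := fun ω i => (X ω i - e i (Z ω)) / σ with hUd
  have hU : Measurable U := by fun_prop
  have hbeq (i : Fin n) (ω : Ω) :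
      Real.log (s i (T ω) / σ) = Real.log (s i (T ω)) - Real.log σ :=
    Real.log_div (hs0 i _).ne' hσ.ne'
  have hU2 (i : Fin n) (ω : Ω) : U ω i ^ 2 = (X ω i - e i (Z ω)) ^ 2 / σ ^ 2 := by
    rw [hUd, div_pow]
  obtain ⟨h0, h1⟩ := klDiv_map_add_mul_gaussian μ hT hN hU hTN hlaw
    (a := fun i t => (m i t - e i (g t)) / σ) (b := fun i t => s i t / σ)
    (by fun_prop) (by fun_prop) (fun i t => div_pos (hs0 i t) hσ)
    (by
      filter_upwards [hXN] with ω hω i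
      simp only [hUd, hω i, hZT ω]
      ring)
    (by
      intro i
      simp only [hbeq]
      exact (hlog i).sub (integrable_const _))
    (by
      intro i
      simp only [hU2]
      exact (hint i).div_const _)
  -- The normalized error has second moment at most 1, so E U²/2 - 1/2 is at most 0 and only the
  -- logarithms remain.
  have hle : ∑ i, ((∫ ω, U ω i ^ 2 ∂μ) / 2 - 1 / 2 - ∫ ω, Real.log (s i (T ω) / σ) ∂μ) ≤
      ∑ i, (Real.log σ - ∫ ω, Real.log (s i (T ω)) ∂μ) := by
    refine Finset.sum_le_sum fun i _ => ?_
    simp only [hbeq, hU2]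
    rw [integral_sub (hlog i) (integrable_const _), integral_div]
    have := (div_le_one (by positivity)).2 (hmse i)
    simp only [integral_const, probReal_univ, one_smul]
    linarith
  refine ⟨h0.trans hle, ?_⟩
  refine (condMutualInfo_le_klDiv_prod μ (Φ := fun (p : ζ × (Fin n → ℝ)) i => e i p.1 + σ * p.2 i) hX hT hU hf hg
    (by fun_prop) hYT hZT (fun ω => ?_) (Measure.pi (fun _ : Fin n => gaussianReal 0 1))).trans ?_
  · ext i
    simp only [hUd]
    field_simp
    ring
  · rw [h1]
    exact ENNReal.ofReal_le_ofReal hle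

end GaussianChannel

end KeyGen

namespace KeyGen

/-! ### Stability of the law of cosines. -/

section Geometry

/-- Length of the third side of a triangle with sides `x`, `y` that enclose the angle `θ`. -/
noncomputable def thirdSide (x y θ : ℝ) : ℝ := √(x ^ 2 + y ^ 2 - 2 * x * y * Real.cos θ)

lemma thirdSide_comm (x y θ : ℝ) : thirdSide x y θ = thirdSide y x θ := by
  unfold thirdSide
  congr 1
  ring

/-- Placing the vertex at the origin of ℂ turns perturbation of a triangle into the triangle
inequality. All real x and y are allowed, as Gaussian noise can make observed lengths negative. -/
lemma thirdSide_eq_norm (x y θ : ℝ) :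
    thirdSide x y θ = ‖(x : ℂ) - y * Complex.exp (Complex.I * θ)‖ := by
  rw [Complex.norm_def, thirdSide]
  congr 1
  have h1 : Complex.exp (Complex.I * θ) = ⟨Real.cos θ, Real.sin θ⟩ := by
    rw [mul_comm]
    apply Complex.ext
    · rw [Complex.exp_ofReal_mul_I_re]
    · rw [Complex.exp_ofReal_mul_I_im]
  rw [h1, Complex.normSq_apply]
  simp
  nlinarith [Real.sin_sq_add_cos_sq θ]

lemma norm_exp_I_mul_sub_le (θ φ : ℝ) :
    ‖Complex.exp (Complex.I * θ) - Complex.exp (Complex.I * φ)‖ ≤ |θ - φ| := by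
  have h : Complex.exp (Complex.I * θ) - Complex.exp (Complex.I * φ) =
      Complex.exp (Complex.I * φ) * (Complex.exp (Complex.I * (θ - φ : ℝ)) - 1) := by
    rw [mul_sub, ← Complex.exp_add]
    push_cast
    ring_nf
  rw [h, norm_mul, mul_comm Complex.I (φ : ℂ), Complex.norm_exp_ofReal_mul_I, one_mul]
  exact Real.norm_exp_I_mul_ofReal_sub_one_le

lemma abs_thirdSide_sub_le_right (x y θ a φ : ℝ) {b : ℝ} (hb : 0 ≤ b) :
    |thirdSide x y θ - thirdSide a b φ| ≤ |x - a| + |y - b| + b * |θ - φ| := by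
  rw [thirdSide_eq_norm, thirdSide_eq_norm]
  refine (abs_norm_sub_norm_le _ _).trans ?_
  have h : (x : ℂ) - y * Complex.exp (Complex.I * θ) - (a - b * Complex.exp (Complex.I * φ)) =
      ((x - a : ℝ) : ℂ) - ((y - b : ℝ) : ℂ) * Complex.exp (Complex.I * θ) -
        (b : ℂ) * (Complex.exp (Complex.I * θ) - Complex.exp (Complex.I * φ)) := by
    push_cast
    ring
  rw [h]
  refine (norm_sub_le _ _).trans (add_le_add ((norm_sub_le _ _).trans (le_of_eq ?_)) ?_)
  · rw [norm_mul, mul_comm Complex.I (θ : ℂ), Complex.norm_exp_ofReal_mul_I, mul_one,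
      Complex.norm_real, Complex.norm_real, Real.norm_eq_abs, Real.norm_eq_abs]
  · rw [norm_mul, Complex.norm_real, Real.norm_eq_abs, abs_of_nonneg hb]
    exact mul_le_mul_of_nonneg_left (norm_exp_I_mul_sub_le θ φ) hb

/-- The angular error rotates one side only, and by symmetry either may be chosen; hence the minimum
of the true lengths. -/
lemma abs_thirdSide_sub_le (x y θ φ : ℝ) {a b : ℝ} (ha : 0 ≤ a) (hb : 0 ≤ b) :
    |thirdSide x y θ - thirdSide a b φ| ≤ |x - a| + |y - b| + min a b * |θ - φ| := by
  rcases min_choice a b with h | h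
  · rw [h, thirdSide_comm x, thirdSide_comm a, add_comm |x - a|]
    exact abs_thirdSide_sub_le_right y x θ b φ ha
  · rw [h]
    exact abs_thirdSide_sub_le_right x y θ a φ hb

lemma sq_thirdSide_sub_le (x y θ φ : ℝ) {a b : ℝ} (ha : 0 ≤ a) (hb : 0 ≤ b) :
    (thirdSide a b φ - thirdSide x y θ) ^ 2 ≤
      3 * ((x - a) ^ 2 + (y - b) ^ 2 + min a b ^ 2 * (θ - φ) ^ 2) := by
  have h := abs_thirdSide_sub_le x y θ φ ha hb
  rw [abs_sub_comm] at h
  have h2 := pow_le_pow_left₀ (abs_nonneg _) h 2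
  rw [sq_abs] at h2
  refine h2.trans ?_
  rw [← sq_abs (x - a), ← sq_abs (y - b), ← sq_abs (θ - φ), ← mul_pow]
  -- (p + q + r)² ≤ 3 (p² + q² + r²), from the three squared differences.
  nlinarith [sq_nonneg (|x - a| - |y - b|), sq_nonneg (|x - a| - min a b * |θ - φ|),
    sq_nonneg (|y - b| - min a b * |θ - φ|)]

lemma dist_eq_thirdSide (p q e : Plane) :
    dist p q = thirdSide (dist p e) (dist q e) (EuclideanGeometry.angle p e q) := by
  rw [thirdSide, ← Real.sqrt_sq (dist_nonneg (x := p) (y := q))]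
  congr 1
  have := EuclideanGeometry.law_cos p e q
  linarith [pow_two (dist p q), pow_two (dist p e), pow_two (dist q e)]

@[fun_prop]
lemma measurable_thirdSide {τ : Type*} [MeasurableSpace τ] {f g h : τ → ℝ} (hf : Measurable f)
    (hg : Measurable g) (hh : Measurable h) : Measurable (fun t => thirdSide (f t) (g t) (h t)) := by
  unfold thirdSide
  fun_prop

@[fun_prop]
lemma measurable_angle {τ : Type*} [MeasurableSpace τ] {f g h : τ → Plane} (hf : Measurable f)
    (hg : Measurable g) (hh : Measurable h) :
    Measurable (fun t => EuclideanGeometry.angle (f t) (g t) (h t)) := by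
  unfold EuclideanGeometry.angle InnerProductGeometry.angle
  simp only [vsub_eq_sub]
  fun_prop

end Geometry

/-! ### Comparison of the error estimate with the integrand of η. -/

section ErrorBound

/-- The integrand of the first expectation in `η`, as a function of the distances and of the
variance factors. -/
noncomputable def errorBound (ρ1 ρe D A B g12 g1 g2 gφ : ℝ) : ℝ :=
  ρe / D ^ 2 * (D ^ 2 * ρ1 / ρe * g12 + 4 * (A + B) ^ 2 * (√g1 + √g2) ^ 2
    + (4 * (A * B) + 64 * (A * B) ^ 2) * gφ
    + 8 * (A + B) * (A * B) * (√g1 + √g2) * √gφ + 64 * (A + B) ^ 2 * (g1 + g2))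

/-- The triangle inequality gives D² ≤ (A + B)² and D min(A, B) ≤ 2AB. After clearing D² the left
side needs coefficients 3 and 12 where `errorBound` offers 64; its remaining terms are nonnegative.
-/
lemma le_errorBound {ρ1 ρe D A B g12 g1 g2 gφ : ℝ} (hρe : 0 < ρe) (hD : 0 < D) (hA : 0 < A)
    (hB : 0 < B) (hAB : D ≤ A + B) (h1 : 0 ≤ g1) (h2 : 0 ≤ g2) (hφ : 0 ≤ gφ) :
    ρ1 * g12 + 3 * (ρe * (g1 + g2 + min A B ^ 2 * gφ)) ≤
      errorBound ρ1 ρe D A B g12 g1 g2 gφ := by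
  have hmin : 0 < min A B := lt_min hA hB
  have hD2 : D ^ 2 ≤ (A + B) ^ 2 := pow_le_pow_left₀ hD.le hAB 2
  have hDm : D * min A B ≤ 2 * (A * B) := by
    have e1 := mul_le_mul_of_nonneg_right hAB hmin.le
    have e2 := mul_le_mul_of_nonneg_left (min_le_right A B) hA.le
    have e3 := mul_le_mul_of_nonneg_left (min_le_left A B) hB.le
    linarith
  have hDm2 : D ^ 2 * min A B ^ 2 ≤ 4 * (A * B) ^ 2 := by
    have := pow_le_pow_left₀ (by positivity) hDm 2
    linarith [this, mul_pow D (min A B) 2, mul_pow 2 (A * B) 2]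
  have hsplit : errorBound ρ1 ρe D A B g12 g1 g2 gφ = ρ1 * g12 + ρe / D ^ 2 *
      (4 * (A + B) ^ 2 * (√g1 + √g2) ^ 2 + (4 * (A * B) + 64 * (A * B) ^ 2) * gφ
    + 8 * (A + B) * (A * B) * (√g1 + √g2) * √gφ + 64 * (A + B) ^ 2 * (g1 + g2)) := by
    unfold errorBound
    field_simp
    ring
  rw [hsplit]
  have hlhs : 3 * (ρe * (g1 + g2 + min A B ^ 2 * gφ)) =
      ρe / D ^ 2 * (3 * (D ^ 2 * (g1 + g2) + D ^ 2 * min A B ^ 2 * gφ)) := by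
    field_simp
  rw [hlhs]
  gcongr
  have e1 := mul_le_mul_of_nonneg_right hD2 (add_nonneg h1 h2)
  have e2 := mul_le_mul_of_nonneg_right hDm2 hφ
  have n1 : 0 ≤ 4 * (A + B) ^ 2 * (√g1 + √g2) ^ 2 := by positivity
  have n2 : 0 ≤ 8 * (A + B) * (A * B) * (√g1 + √g2) * √gφ := by positivity
  have n3 : 0 ≤ (A * B) * gφ := by positivity
  have n4 : 0 ≤ (A * B) ^ 2 * gφ := by positivity
  have n5 : 0 ≤ (A + B) ^ 2 * (g1 + g2) := by positivity
  nlinarith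

/-- A continuous function on a compact box with D away from 0. The variance factors are separate
variables because γ and γφ need not be continuous; monotonicity confines their values to intervals.
-/
lemma exists_errorBound_bound (ρ1 ρe : ℝ) {d d' g g' p p' : ℝ} (hd : 0 < d) :
    ∃ C, ∀ D ∈ Set.Icc d d', ∀ A ∈ Set.Icc d d', ∀ B ∈ Set.Icc d d', ∀ g12 ∈ Set.Icc g g',
      ∀ g1 ∈ Set.Icc g g', ∀ g2 ∈ Set.Icc g g', ∀ gφ ∈ Set.Icc p p',
        ‖errorBound ρ1 ρe D A B g12 g1 g2 gφ‖ ≤ C := by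
  have hK : IsCompact (Set.Icc d d' ×ˢ Set.Icc d d' ×ˢ Set.Icc d d' ×ˢ Set.Icc g g' ×ˢ
      Set.Icc g g' ×ˢ Set.Icc g g' ×ˢ Set.Icc p p') :=
    isCompact_Icc.prod (isCompact_Icc.prod (isCompact_Icc.prod (isCompact_Icc.prod
      (isCompact_Icc.prod (isCompact_Icc.prod isCompact_Icc)))))
  obtain ⟨C, hC⟩ := hK.exists_bound_of_continuousOn
    (f := fun x : ℝ × ℝ × ℝ × ℝ × ℝ × ℝ × ℝ =>
      errorBound ρ1 ρe x.1 x.2.1 x.2.2.1 x.2.2.2.1 x.2.2.2.2.1 x.2.2.2.2.2.1 x.2.2.2.2.2.2) (by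
    unfold errorBound
    refine ContinuousOn.mul (ContinuousOn.div (by fun_prop) (by fun_prop) ?_) (by fun_prop)
    rintro x ⟨hx, -⟩
    exact pow_ne_zero 2 (hd.trans_le hx.1).ne')
  refine ⟨C, fun D hD A hA B hB g12 h12 g1 h1 g2 h2 gφ hφ => ?_⟩
  exact hC (D, A, B, g12, g1, g2, gφ) ⟨hD, hA, hB, h12, h1, h2, hφ⟩

end ErrorBound

end KeyGen

/-! ### The model: sources of randomness, measurability, independence and integrability. -/

namespace KeyGen

lemma mutualInfo_const_left {Ω α β : Type*} [MeasurableSpace Ω] [MeasurableSpace α]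
    [MeasurableSpace β] (μ : Measure Ω) [IsProbabilityMeasure μ] (c : α) {Y : Ω → β}
    (hY : Measurable Y) : mutualInfo μ (fun _ => c) Y = 0 := by
  have : IsProbabilityMeasure (μ.map Y) := Measure.isProbabilityMeasure_map hY.aemeasurable
  have h : μ.map (fun ω => (c, Y ω)) = (μ.map (fun _ : Ω => c)).prod (μ.map Y) := by
    rw [Measure.map_const, measure_univ, one_smul, Measure.dirac_prod,
      Measure.map_map (by fun_prop) hY]
    rfl
  rw [mutualInfo, h]
  exact klDiv_self _

lemma indepFun_prodMk_left {Ω α β γ : Type*} [MeasurableSpace Ω] [MeasurableSpace α]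
    [MeasurableSpace β] [MeasurableSpace γ] {μ : Measure Ω} [IsProbabilityMeasure μ]
    {S : Ω → α} {V : Ω → β} {N : Ω → γ} (hS : Measurable S) (hV : Measurable V)
    (hN : Measurable N) (h1 : IndepFun S (fun ω => (V ω, N ω)) μ) (h2 : IndepFun V N μ) :
    IndepFun (fun ω => (S ω, V ω)) N μ := by
  have : IsProbabilityMeasure (μ.map S) := Measure.isProbabilityMeasure_map hS.aemeasurable
  have : IsProbabilityMeasure (μ.map V) := Measure.isProbabilityMeasure_map hV.aemeasurable
  have : IsProbabilityMeasure (μ.map N) := Measure.isProbabilityMeasure_map hN.aemeasurable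
  rw [indepFun_iff_map_prod_eq_prod_map_map (hS.prodMk hV).aemeasurable hN.aemeasurable]
  have h3 := h1.map_prod_eq_prod_map_map hS.aemeasurable (hV.prodMk hN).aemeasurable
  rw [h2.map_prod_eq_prod_map_map hV.aemeasurable hN.aemeasurable] at h3
  have h4 : IndepFun S V μ := h1.comp (φ := id) (ψ := Prod.fst) measurable_id measurable_fst
  rw [h4.map_prod_eq_prod_map_map hS.aemeasurable hV.aemeasurable]
  have h5 : μ.map (fun ω => ((S ω, V ω), N ω)) =
      (μ.map (fun ω => (S ω, V ω, N ω))).map MeasurableEquiv.prodAssoc.symm := by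
    rw [Measure.map_map (by fun_prop) (by fun_prop)]
    rfl
  rw [h5, h3]
  exact (measurePreserving_prodAssoc _ _ _).symm.map_eq

namespace Model

variable {Ω : Type*} (M : Model Ω)

/-- The noise of node 1 in the first `n` slots. -/
def noise1 (n : ℕ) (ω : Ω) (i : Fin n) : ℝ := M.Z .dist1 i ω

/-- The noises of node 2 and of the eavesdropper in the first `n` slots. -/
def otherNoise (n : ℕ) (ω : Ω) (i : Fin n) : ℝ × ℝ × ℝ × ℝ :=
  (M.Z .dist2 i ω, M.Z .dist1e i ω, M.Z .dist2e i ω, M.Z .angle i ω)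

/-- All sources of randomness in the first `n` slots except for the noise of node 1. -/
def sources (n : ℕ) (ω : Ω) : (ℕ → Plane × Plane × Plane) × (Fin n → ℝ × ℝ × ℝ × ℝ) :=
  (fun i => M.state i ω, M.otherNoise n ω)

/-- The integrand of the first expectation in `η`, as a function of the locations. -/
noncomputable def stateErr (q : Plane × Plane × Plane) : ℝ :=
  errorBound M.ρ1 M.ρe (dist q.1 q.2.1) (dist q.1 q.2.2) (dist q.2.1 q.2.2)
    (M.γ (dist q.1 q.2.1)) (M.γ (dist q.1 q.2.2)) (M.γ (dist q.2.1 q.2.2))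
    (M.γφ (dist q.1 q.2.2) (dist q.2.1 q.2.2))

/-- The estimate of `d₁₂` that the eavesdropper computes from an observation by the law of
cosines. -/
noncomputable def estimate (P : ℝ) (i : ℕ) (ω : Ω) : ℝ :=
  thirdSide (M.dhat1e P i ω) (M.dhat2e P i ω) (M.phihat P i ω)

lemma etaInner_eq (ω : Ω) : M.etaInner ω = M.stateErr (M.state 0 ω) := rfl

/-- The observations of node 2 as a function of the sources. -/
noncomputable def obs2Of (P : ℝ) (n : ℕ)
    (t : (ℕ → Plane × Plane × Plane) × (Fin n → ℝ × ℝ × ℝ × ℝ)) (i : Fin n) : ℝ :=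
  dist (t.1 i).1 (t.1 i).2.1 + √(M.γ (dist (t.1 i).1 (t.1 i).2.1) * M.ρ2 / P) * (t.2 i).1

/-- The observations of the eavesdropper, including the angle, as a function of the sources. -/
noncomputable def obsEOf (P : ℝ) (n : ℕ)
    (t : (ℕ → Plane × Plane × Plane) × (Fin n → ℝ × ℝ × ℝ × ℝ)) (i : Fin n) : ℝ × ℝ × ℝ :=
  (dist (t.1 i).1 (t.1 i).2.2 + √(M.γ (dist (t.1 i).1 (t.1 i).2.2) * M.ρe / P) * (t.2 i).2.1,
    dist (t.1 i).2.1 (t.1 i).2.2 +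
      √(M.γ (dist (t.1 i).2.1 (t.1 i).2.2) * M.ρe / P) * (t.2 i).2.2.1,
    EuclideanGeometry.angle (t.1 i).1 (t.1 i).2.2 (t.1 i).2.1 +
      √(M.γφ (dist (t.1 i).1 (t.1 i).2.2) (dist (t.1 i).2.1 (t.1 i).2.2) * M.ρe / P) *
        (t.2 i).2.2.2)

variable {M} in
lemma obsE_eq_obsEOf (hobs : M.observesAngle = true) (P : ℝ) (n : ℕ) (ω : Ω) :
    M.obsE P n ω = M.obsEOf P n (M.sources n ω) := by
  funext i
  simp only [obsE, phihat, hobs, if_true]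
  rfl

/-- Standard deviation of the observation of node 1, with the distance clamped to
`[dMin, dMax]`. -/
noncomputable def noiseScale (P : ℝ) (q : Plane × Plane × Plane) : ℝ :=
  √(M.γ (max M.dMin (min (dist q.1 q.2.1) M.dMax)) * M.ρ1 / P)

/-- The mutual distances of a triple of locations lie in `[dMin, dMax]`. -/
def Admissible (q : Plane × Plane × Plane) : Prop :=
  dist q.1 q.2.1 ∈ Set.Icc M.dMin M.dMax ∧ dist q.1 q.2.2 ∈ Set.Icc M.dMin M.dMax ∧
    dist q.2.1 q.2.2 ∈ Set.Icc M.dMin M.dMax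

variable {M} [MeasurableSpace Ω] {μ : Measure Ω}

namespace IsGaussian

lemma measurable_state (hM : M.IsGaussian μ) (i : ℕ) : Measurable (M.state i) :=
  (hM.meas_l1 i).prodMk ((hM.meas_l2 i).prodMk (hM.meas_le i))

lemma measurable_noise1 (hM : M.IsGaussian μ) (n : ℕ) : Measurable (M.noise1 n) :=
  measurable_pi_lambda _ fun i => hM.meas_Z _ i

lemma measurable_otherNoise (hM : M.IsGaussian μ) (n : ℕ) : Measurable (M.otherNoise n) :=
  measurable_pi_lambda _ fun i => (hM.meas_Z _ i).prodMk ((hM.meas_Z _ i).prodMk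
    ((hM.meas_Z _ i).prodMk (hM.meas_Z _ i)))

lemma measurable_sources (hM : M.IsGaussian μ) (n : ℕ) : Measurable (M.sources n) :=
  (measurable_pi_lambda _ fun i => hM.measurable_state i).prodMk (hM.measurable_otherNoise n)

lemma measurable_γφ (hM : M.IsGaussian μ) {τ : Type*} [MeasurableSpace τ] {f g : τ → ℝ}
    (hf : Measurable f) (hg : Measurable g) : Measurable (fun t => M.γφ (f t) (g t)) :=
  hM.meas_γφ.comp (hf.prodMk hg)

lemma measurable_obs2Of (hM : M.IsGaussian μ) (P : ℝ) (n : ℕ) : Measurable (M.obs2Of P n) := by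
  have h := hM.meas_γ
  unfold obs2Of
  fun_prop

lemma measurable_obsEOf (hM : M.IsGaussian μ) (P : ℝ) (n : ℕ) : Measurable (M.obsEOf P n) := by
  have h := hM.meas_γ
  refine measurable_pi_lambda _ fun i => ?_
  have h2 := hM.measurable_γφ (τ := (ℕ → Plane × Plane × Plane) × (Fin n → ℝ × ℝ × ℝ × ℝ))
    (f := fun t => dist (t.1 i).1 (t.1 i).2.2) (g := fun t => dist (t.1 i).2.1 (t.1 i).2.2)
    (by fun_prop) (by fun_prop)
  unfold obsEOf
  fun_prop

lemma measurable_obs1 (hM : M.IsGaussian μ) (P : ℝ) (n : ℕ) : Measurable (M.obs1 P n) := by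
  refine measurable_pi_lambda _ fun i => ?_
  have h := hM.meas_γ
  have h1 := hM.meas_l1 i
  have h2 := hM.meas_l2 i
  have h3 := hM.meas_Z .dist1 i
  unfold obs1 dhat1 d12
  fun_prop

lemma measurable_phiVec (hM : M.IsGaussian μ) (n : ℕ) : Measurable (M.phiVec n) :=
  measurable_pi_lambda _ fun i =>
    measurable_angle (hM.meas_l1 i) (hM.meas_le i) (hM.meas_l2 i)

lemma measurable_noiseScale (hM : M.IsGaussian μ) (P : ℝ) : Measurable (M.noiseScale P) := by
  have h := hM.meas_γ
  unfold noiseScale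
  fun_prop

lemma measurable_stateErr (hM : M.IsGaussian μ) : Measurable M.stateErr := by
  have h := hM.meas_γ
  have h2 := hM.measurable_γφ (τ := Plane × Plane × Plane)
    (f := fun q => dist q.1 q.2.2) (g := fun q => dist q.2.1 q.2.2) (by fun_prop) (by fun_prop)
  unfold stateErr errorBound
  fun_prop

/-- A constant carries no information. The angle hypothesis enters the theorem only through this
conclusion. -/
lemma observesAngle_of_mutualInfo_pos [IsProbabilityMeasure μ] (hM : M.IsGaussian μ) {P : ℝ} {n : ℕ}
    (h : 0 < mutualInfo μ (M.phihatVec P n) (M.phiVec n)) : M.observesAngle = true := by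
  by_contra hobs
  have h1 : M.phihatVec P n = fun _ => fun _ => 0 := by
    funext ω i
    simp [phihatVec, phihat, hobs]
  rw [h1, mutualInfo_const_left μ _ (hM.measurable_phiVec n)] at h
  exact h.ne' rfl

lemma ae_admissible (hM : M.IsGaussian μ) (i : ℕ) : ∀ᵐ ω ∂μ, M.Admissible (M.state i ω) := by
  filter_upwards [hM.d12_mem i, hM.d1e_mem i, hM.d2e_mem i] with ω h1 h2 h3
  exact ⟨h1, h2, h3⟩

lemma dMin_le_dMax [IsProbabilityMeasure μ] (hM : M.IsGaussian μ) : M.dMin ≤ M.dMax := by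
  obtain ⟨ω, hω⟩ := (hM.d12_mem 0).exists
  exact hω.1.trans hω.2

lemma γ_mem [IsProbabilityMeasure μ] (hM : M.IsGaussian μ) {x : ℝ} (hx : x ∈ Set.Icc M.dMin M.dMax) :
    M.γ x ∈ Set.Icc (M.γ M.dMin) (M.γ M.dMax) :=
  ⟨hM.mono_γ ⟨le_rfl, hM.dMin_le_dMax⟩ hx hx.1, hM.mono_γ hx ⟨hM.dMin_le_dMax, le_rfl⟩ hx.2⟩

lemma γφ_mem [IsProbabilityMeasure μ] (hM : M.IsGaussian μ) {x y : ℝ} (hx : x ∈ Set.Icc M.dMin M.dMax)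
    (hy : y ∈ Set.Icc M.dMin M.dMax) :
    M.γφ x y ∈ Set.Icc (M.γφ M.dMin M.dMin) (M.γφ M.dMax M.dMax) := by
  have hl : M.dMin ∈ Set.Icc M.dMin M.dMax := ⟨le_rfl, hM.dMin_le_dMax⟩
  have hr : M.dMax ∈ Set.Icc M.dMin M.dMax := ⟨hM.dMin_le_dMax, le_rfl⟩
  exact ⟨hM.mono_γφ (a := (M.dMin, M.dMin)) (b := (x, y)) ⟨hl, hl⟩ ⟨hx, hy⟩ ⟨hx.1, hy.1⟩,
    hM.mono_γφ (a := (x, y)) (b := (M.dMax, M.dMax)) ⟨hx, hy⟩ ⟨hr, hr⟩ ⟨hx.2, hy.2⟩⟩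

lemma γ_dMin_pos [IsProbabilityMeasure μ] (hM : M.IsGaussian μ) : 0 < M.γ M.dMin :=
  hM.γ_pos _ ⟨le_rfl, hM.dMin_le_dMax⟩

lemma integrable_comp_state [IsProbabilityMeasure μ] (hM : M.IsGaussian μ) {F : Plane × Plane × Plane → ℝ}
    (hF : Measurable F) {C : ℝ} (hC : ∀ q, M.Admissible q → ‖F q‖ ≤ C) (i : ℕ) :
    Integrable (fun ω => F (M.state i ω)) μ := by
  refine Integrable.of_bound (hF.comp (hM.measurable_state i)).aestronglyMeasurable C ?_
  filter_upwards [hM.ae_admissible i] with ω hω using hC _ hω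

/-- Moves expectations from slot i to slot 0, in which η is expressed. -/
lemma integral_comp_state (hM : M.IsGaussian μ) {F : Plane × Plane × Plane → ℝ}
    (hF : Measurable F) (i : ℕ) :
    ∫ ω, F (M.state i ω) ∂μ = ∫ ω, F (M.state 0 ω) ∂μ := by
  rw [← integral_map (hM.measurable_state i).aemeasurable hF.aestronglyMeasurable, hM.stationary i,
    integral_map (hM.measurable_state 0).aemeasurable hF.aestronglyMeasurable]

lemma indepFun_state_noise (hM : M.IsGaussian μ) (c : Channel) (i : ℕ) :
    IndepFun (M.state i) (M.Z c i) μ :=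
  hM.indep_state.comp (φ := fun s : ℕ → Plane × Plane × Plane => s i)
    (ψ := fun z : Channel × ℕ → ℝ => z (c, i)) (measurable_pi_apply i)
    (measurable_pi_apply (c, i))

lemma integrable_mul_sq_noise (hM : M.IsGaussian μ) {F : Plane × Plane × Plane → ℝ}
    (hF : Measurable F) {i : ℕ} (hi : Integrable (fun ω => F (M.state i ω)) μ) (c : Channel) :
    Integrable (fun ω => F (M.state i ω) * M.Z c i ω ^ 2) μ :=
  ((hM.indepFun_state_noise c i).comp hF (measurable_id.pow_const 2)).integrable_mul hi
    (integrable_sq_gaussian (hM.meas_Z c i) (hM.law_Z c i))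

lemma integral_mul_sq_noise (hM : M.IsGaussian μ) {F : Plane × Plane × Plane → ℝ}
    (hF : Measurable F) (i : ℕ) (c : Channel) :
    ∫ ω, F (M.state i ω) * M.Z c i ω ^ 2 ∂μ = ∫ ω, F (M.state i ω) ∂μ := by
  have h := ((hM.indepFun_state_noise c i).comp hF
    (measurable_id.pow_const 2)).integral_fun_mul_eq_mul_integral
    (hF.comp (hM.measurable_state i)).aestronglyMeasurable
    ((measurable_id.pow_const 2).comp (hM.meas_Z c i)).aestronglyMeasurable
  simp only [Function.comp_def, id_eq] at h
  rw [h, integral_sq_gaussian (hM.meas_Z c i) (hM.law_Z c i), mul_one]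

lemma indepFun_sources_noise1 [IsProbabilityMeasure μ] (hM : M.IsGaussian μ) (n : ℕ) :
    IndepFun (M.sources n) (M.noise1 n) μ := by
  classical
  refine indepFun_prodMk_left (measurable_pi_lambda _ fun i => hM.measurable_state i)
    (hM.measurable_otherNoise n) (hM.measurable_noise1 n) ?_ ?_
  · exact hM.indep_state.comp (φ := id)
      (ψ := fun z : Channel × ℕ → ℝ => ((fun i : Fin n => (z (.dist2, i), z (.dist1e, i), z (.dist2e, i),
        z (.angle, i))), fun i : Fin n => z (.dist1, i))) measurable_id (by fun_prop)
  -- The two groups of noises are functions of disjoint finite blocks of one jointly independent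
  -- family.
  · set S : Finset (Channel × ℕ) :=
      ({.dist2, .dist1e, .dist2e, .angle} : Finset Channel) ×ˢ Finset.range n with hS
    set R : Finset (Channel × ℕ) := ({.dist1} : Finset Channel) ×ˢ Finset.range n with hR
    have hd : Disjoint S R := by
      rw [Finset.disjoint_left]
      rintro ⟨c, i⟩ h1 h2
      simp only [hS, hR, Finset.mem_product, Finset.mem_singleton] at h1 h2
      simp [h2.1] at h1
    have hmem (c : Channel) (hc : c ∈ ({.dist2, .dist1e, .dist2e, .angle} : Finset Channel))
        (i : Fin n) : (c, (i : ℕ)) ∈ S :=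
      Finset.mem_product.2 ⟨hc, Finset.mem_range.2 i.2⟩
    have hmem1 (i : Fin n) : (Channel.dist1, (i : ℕ)) ∈ R :=
      Finset.mem_product.2 ⟨Finset.mem_singleton_self _, Finset.mem_range.2 i.2⟩
    exact (hM.indep_Z.indepFun_finset S R hd fun k => hM.meas_Z k.1 k.2).comp
      (φ := fun (z : S → ℝ) (i : Fin n) => (z ⟨(.dist2, i), hmem _ (by simp) i⟩,
        z ⟨(.dist1e, i), hmem _ (by simp) i⟩, z ⟨(.dist2e, i), hmem _ (by simp) i⟩,
        z ⟨(.angle, i), hmem _ (by simp) i⟩))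
      (ψ := fun (z : R → ℝ) (i : Fin n) => z ⟨(.dist1, i), hmem1 i⟩) (by fun_prop) (by fun_prop)

lemma map_noise1 [IsProbabilityMeasure μ] (hM : M.IsGaussian μ) (n : ℕ) :
    μ.map (M.noise1 n) = Measure.pi (fun _ => gaussianReal 0 1) := by
  have h : iIndepFun (fun i : Fin n => M.Z .dist1 i) μ :=
    hM.indep_Z.precomp (g := fun i : Fin n => (Channel.dist1, (i : ℕ)))
      fun i j hij => Fin.ext (Prod.ext_iff.1 hij).2
  have h1 := (iIndepFun_iff_map_fun_eq_pi_map fun i : Fin n =>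
    (hM.meas_Z .dist1 i).aemeasurable).1 h
  simp only [hM.law_Z] at h1
  exact h1

lemma stateErr_bound [IsProbabilityMeasure μ] (hM : M.IsGaussian μ) : ∃ C, ∀ q, M.Admissible q → ‖M.stateErr q‖ ≤ C := by
  obtain ⟨C, hC⟩ := exists_errorBound_bound M.ρ1 M.ρe (d := M.dMin) (d' := M.dMax)
    (g := M.γ M.dMin) (g' := M.γ M.dMax) (p := M.γφ M.dMin M.dMin) (p' := M.γφ M.dMax M.dMax)
    hM.dMin_pos
  exact ⟨C, fun q ⟨h12, h1, h2⟩ => hC _ h12 _ h1 _ h2 _ (hM.γ_mem h12) _ (hM.γ_mem h1) _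
    (hM.γ_mem h2) _ (hM.γφ_mem h1 h2)⟩

lemma integrable_stateErr [IsProbabilityMeasure μ] (hM : M.IsGaussian μ) (i : ℕ) :
    Integrable (fun ω => M.stateErr (M.state i ω)) μ :=
  let ⟨_, hC⟩ := hM.stateErr_bound
  hM.integrable_comp_state hM.measurable_stateErr hC i

lemma le_stateErr (hM : M.IsGaussian μ) {q : Plane × Plane × Plane} (hq : M.Admissible q) :
    M.ρ1 * M.γ (dist q.1 q.2.1) + 3 * (M.ρe * (M.γ (dist q.1 q.2.2) + M.γ (dist q.2.1 q.2.2) +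
      min (dist q.1 q.2.2) (dist q.2.1 q.2.2) ^ 2 *
        M.γφ (dist q.1 q.2.2) (dist q.2.1 q.2.2))) ≤ M.stateErr q := by
  obtain ⟨h12, h1, h2⟩ := hq
  refine le_errorBound hM.ρe_pos (hM.dMin_pos.trans_le h12.1) (hM.dMin_pos.trans_le h1.1)
    (hM.dMin_pos.trans_le h2.1) ?_ (hM.γ_pos _ h1).le (hM.γ_pos _ h2).le (hM.γφ_pos _ h1 _ h2).le
  rw [dist_comm q.2.1 q.2.2]
  exact dist_triangle _ _ _

/-- The contribution of node 1's own noise alone is at least `ρ1 * γ dMin`, which is positive. -/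
lemma integral_etaInner_pos [IsProbabilityMeasure μ] (hM : M.IsGaussian μ) : 0 < ∫ ω, M.etaInner ω ∂μ := by
  simp only [etaInner_eq]
  have h1 : ∫ _, M.ρ1 * M.γ M.dMin ∂μ ≤ ∫ ω, M.stateErr (M.state 0 ω) ∂μ := by
    refine integral_mono_ae (integrable_const _) (hM.integrable_stateErr 0) ?_
    filter_upwards [hM.ae_admissible 0] with ω hω
    refine le_trans ?_ (hM.le_stateErr hω)
    have e1 := mul_le_mul_of_nonneg_left (hM.γ_mem hω.1).1 hM.ρ1_pos.le
    have e2 := (hM.γ_pos _ hω.2.1).le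
    have e3 := (hM.γ_pos _ hω.2.2).le
    have e4 := (hM.γφ_pos _ hω.2.1 _ hω.2.2).le
    have e5 := hM.ρe_pos.le
    refine e1.trans (le_add_of_nonneg_right ?_)
    positivity
  refine lt_of_lt_of_le ?_ h1
  simpa using mul_pos hM.ρ1_pos hM.γ_dMin_pos

lemma integrable_etaLog [IsProbabilityMeasure μ] (hM : M.IsGaussian μ) : Integrable M.etaLog μ := by
  have hγ := hM.meas_γ
  have hc : 0 < 2 * Real.pi * M.ρ1 := by have := hM.ρ1_pos; positivity
  obtain ⟨C, hC⟩ := (isCompact_Icc (a := M.γ M.dMin) (b := M.γ M.dMax)).exists_bound_of_continuousOn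
    (f := fun g => Real.log (2 * Real.pi * M.ρ1 * g))
    (ContinuousOn.log (by fun_prop) fun g hg =>
      (mul_pos hc (hM.γ_dMin_pos.trans_le hg.1)).ne')
  exact hM.integrable_comp_state
    (F := fun q => Real.log (2 * Real.pi * M.ρ1 * M.γ (dist q.1 q.2.1))) (by fun_prop)
    (fun q hq => hC _ (hM.γ_mem hq.1)) 0

end IsGaussian

end Model

end KeyGen

/-! ### Mean square error of the eavesdropper, cancellation of the power, and the final bound. -/

namespace KeyGen.Model

variable {Ω : Type*} {M : Model Ω}

lemma noiseScale_eq (P : ℝ) {q : Plane × Plane × Plane} (hq : M.Admissible q) :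
    M.noiseScale P q = √(M.γ (dist q.1 q.2.1) * M.ρ1 / P) := by
  rw [noiseScale, min_eq_left hq.1.2, max_eq_right hq.1.1]

lemma sq_sub_estimate_le (hobs : M.observesAngle = true) (P : ℝ) (i : ℕ) {ω : Ω}
    (h1 : 0 ≤ M.γ (M.d1e i ω) * M.ρe / P) (h2 : 0 ≤ M.γ (M.d2e i ω) * M.ρe / P)
    (hφ : 0 ≤ M.γφ (M.d1e i ω) (M.d2e i ω) * M.ρe / P) :
    (M.d12 i ω - M.estimate P i ω) ^ 2 ≤
      3 * (M.γ (M.d1e i ω) * M.ρe / P * M.Z .dist1e i ω ^ 2 +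
        M.γ (M.d2e i ω) * M.ρe / P * M.Z .dist2e i ω ^ 2 +
        min (M.d1e i ω) (M.d2e i ω) ^ 2 * (M.γφ (M.d1e i ω) (M.d2e i ω) * M.ρe / P) *
          M.Z .angle i ω ^ 2) := by
  have h := sq_thirdSide_sub_le (M.dhat1e P i ω) (M.dhat2e P i ω) (M.phihat P i ω) (M.phi i ω)
    (a := M.d1e i ω) (b := M.d2e i ω) dist_nonneg dist_nonneg
  have hd : M.d12 i ω = thirdSide (M.d1e i ω) (M.d2e i ω) (M.phi i ω) := dist_eq_thirdSide _ _ _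
  rw [hd, estimate]
  refine h.trans (le_of_eq ?_)
  simp only [dhat1e, dhat2e, phihat, hobs, if_true, add_sub_cancel_left, mul_pow,
    Real.sq_sqrt h1, Real.sq_sqrt h2, Real.sq_sqrt hφ]
  ring

variable [MeasurableSpace Ω] {μ : Measure Ω}

namespace IsGaussian

/-- Mean square error of the eavesdropper's estimate of the observation of node 1. -/
lemma integral_sq_dhat1_sub_estimate_le [IsProbabilityMeasure μ] (hM : M.IsGaussian μ)
    (hobs : M.observesAngle = true) {P : ℝ} (hP : 0 < P) (i : ℕ) :
    Integrable (fun ω => (M.dhat1 P i ω - M.estimate P i ω) ^ 2) μ ∧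
    ∫ ω, (M.dhat1 P i ω - M.estimate P i ω) ^ 2 ∂μ ≤ (∫ ω, M.etaInner ω ∂μ) / P := by
  have hγ := hM.meas_γ
  have hγφ := hM.measurable_γφ (τ := Plane × Plane × Plane)
    (f := fun q => dist q.1 q.2.2) (g := fun q => dist q.2.1 q.2.2) (by fun_prop) (by fun_prop)
  have hρ1 := hM.ρ1_pos
  have hρe := hM.ρe_pos
  set F0 : Plane × Plane × Plane → ℝ := fun q => M.γ (dist q.1 q.2.1) * M.ρ1 / P with hF0
  set F1 : Plane × Plane × Plane → ℝ := fun q => M.γ (dist q.1 q.2.2) * M.ρe / P with hF1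
  set F2 : Plane × Plane × Plane → ℝ := fun q => M.γ (dist q.2.1 q.2.2) * M.ρe / P with hF2
  set F3 : Plane × Plane × Plane → ℝ := fun q => min (dist q.1 q.2.2) (dist q.2.1 q.2.2) ^ 2 *
    (M.γφ (dist q.1 q.2.2) (dist q.2.1 q.2.2) * M.ρe / P) with hF3
  have mF0 : Measurable F0 := by fun_prop
  have mF1 : Measurable F1 := by fun_prop
  have mF2 : Measurable F2 := by fun_prop
  have mF3 : Measurable F3 := by fun_prop
  have hnn (q : Plane × Plane × Plane) (hq : M.Admissible q) :
      0 ≤ F0 q ∧ 0 ≤ F1 q ∧ 0 ≤ F2 q ∧ 0 ≤ F3 q := by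
    have e1 := (hM.γ_pos _ hq.1).le
    have e2 := (hM.γ_pos _ hq.2.1).le
    have e3 := (hM.γ_pos _ hq.2.2).le
    have e4 := (hM.γφ_pos _ hq.2.1 _ hq.2.2).le
    simp only [hF0, hF1, hF2, hF3]
    refine ⟨by positivity, by positivity, by positivity, by positivity⟩
  have hle (q : Plane × Plane × Plane) (hq : M.Admissible q) :
      F0 q + 3 * (F1 q + F2 q + F3 q) ≤ M.stateErr q / P := by
    rw [le_div_iff₀ hP]
    refine le_trans (le_of_eq ?_) (hM.le_stateErr hq)
    simp only [hF0, hF1, hF2, hF3]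
    field_simp
  obtain ⟨C, hC⟩ := hM.stateErr_bound
  have hCP (q : Plane × Plane × Plane) (hq : M.Admissible q) : M.stateErr q / P ≤ C / P :=
    div_le_div_of_nonneg_right ((le_abs_self _).trans (hC q hq)) hP.le
  -- Each of the four terms lies between 0 and the bounded function `stateErr / P` on admissible
  -- locations, hence is integrable.
  have hint (F : Plane × Plane × Plane → ℝ) (mF : Measurable F)
      (hF : ∀ q, M.Admissible q → 0 ≤ F q ∧ F q ≤ F0 q + 3 * (F1 q + F2 q + F3 q)) :
      Integrable (fun ω => F (M.state i ω)) μ := by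
    refine hM.integrable_comp_state mF (C := C / P) (fun q hq => ?_) i
    rw [Real.norm_eq_abs, abs_of_nonneg (hF q hq).1]
    exact (hF q hq).2.trans ((hle q hq).trans (hCP q hq))
  have iF0 := hint F0 mF0 fun q hq => by
    obtain ⟨n0, n1, n2, n3⟩ := hnn q hq
    exact ⟨n0, by linarith⟩
  have iF1 := hint F1 mF1 fun q hq => by
    obtain ⟨n0, n1, n2, n3⟩ := hnn q hq
    exact ⟨n1, by linarith⟩
  have iF2 := hint F2 mF2 fun q hq => by
    obtain ⟨n0, n1, n2, n3⟩ := hnn q hq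
    exact ⟨n2, by linarith⟩
  have iF3 := hint F3 mF3 fun q hq => by
    obtain ⟨n0, n1, n2, n3⟩ := hnn q hq
    exact ⟨n3, by linarith⟩
  have iZ0 := hM.integrable_mul_sq_noise mF0 iF0 .dist1
  have iZ1 := hM.integrable_mul_sq_noise mF1 iF1 .dist1e
  have iZ2 := hM.integrable_mul_sq_noise mF2 iF2 .dist2e
  have iZ3 := hM.integrable_mul_sq_noise mF3 iF3 .angle
  set h : Ω → ℝ := fun ω => M.d12 i ω - M.estimate P i ω with hh
  set s : Ω → ℝ := fun ω => √(F0 (M.state i ω)) with hs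
  -- `h` and `s` are functions of the sources
  set f : (ℕ → Plane × Plane × Plane) × (Fin (i + 1) → ℝ × ℝ × ℝ × ℝ) → ℝ := fun t =>
    dist (t.1 i).1 (t.1 i).2.1 - thirdSide (M.obsEOf P (i + 1) t (Fin.last i)).1
      (M.obsEOf P (i + 1) t (Fin.last i)).2.1 (M.obsEOf P (i + 1) t (Fin.last i)).2.2 with hf
  have mf : Measurable f := by
    have := measurable_pi_iff.1 (hM.measurable_obsEOf P (i + 1)) (Fin.last i)
    exact Measurable.sub (by fun_prop) (measurable_thirdSide this.fst this.snd.fst this.snd.snd)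
  have hfh (ω : Ω) : h ω = f (M.sources (i + 1) ω) := by
    simp only [hf, hh, ← obsE_eq_obsEOf hobs]
    rfl
  have mh : Measurable h := by
    rw [funext hfh]
    exact mf.comp (hM.measurable_sources _)
  have ms : Measurable s := (mF0.comp (hM.measurable_state i)).sqrt
  have mZ := hM.meas_Z .dist1 i
  have hh2 : ∀ᵐ ω ∂μ, h ω ^ 2 ≤ 3 * (F1 (M.state i ω) * M.Z .dist1e i ω ^ 2 +
      F2 (M.state i ω) * M.Z .dist2e i ω ^ 2 + F3 (M.state i ω) * M.Z .angle i ω ^ 2) := by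
    filter_upwards [hM.ae_admissible i] with ω hω
    obtain ⟨n0, n1, n2, n3⟩ := hnn _ hω
    refine sq_sub_estimate_le hobs P i n1 n2 ?_
    exact div_nonneg (mul_nonneg (hM.γφ_pos _ hω.2.1 _ hω.2.2).le hρe.le) hP.le
  have iZ12 : Integrable (fun ω => F1 (M.state i ω) * M.Z .dist1e i ω ^ 2 +
      F2 (M.state i ω) * M.Z .dist2e i ω ^ 2) μ := iZ1.add iZ2
  have ibd : Integrable (fun ω => 3 * (F1 (M.state i ω) * M.Z .dist1e i ω ^ 2 +
      F2 (M.state i ω) * M.Z .dist2e i ω ^ 2 + F3 (M.state i ω) * M.Z .angle i ω ^ 2)) μ :=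
    (iZ12.add iZ3).const_mul 3
  have ih2 : Integrable (fun ω => h ω ^ 2) μ := by
    refine ibd.mono' (mh.pow_const 2).aestronglyMeasurable ?_
    filter_upwards [hh2] with ω hω
    rwa [Real.norm_eq_abs, abs_of_nonneg (sq_nonneg _)]
  have hs2 : ∀ᵐ ω ∂μ, s ω ^ 2 = F0 (M.state i ω) := by
    filter_upwards [hM.ae_admissible i] with ω hω
    exact Real.sq_sqrt (hnn _ hω).1
  have ihs : Integrable (fun ω => h ω * s ω) μ := by
    refine (ih2.add iF0).mono' (mh.mul ms).aestronglyMeasurable ?_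
    filter_upwards [hs2] with ω hω
    simp only [Pi.add_apply]
    rw [← hω, Real.norm_eq_abs, abs_le]
    constructor <;> nlinarith [sq_nonneg (h ω + s ω), sq_nonneg (h ω - s ω), sq_nonneg (h ω),
      sq_nonneg (s ω)]
  -- The estimation error `h` and the scale `s` may depend on each other, but both avoid node 1's
  -- noise; as that noise has mean 0, the cross term of the square integrates to 0.
  have hind : IndepFun (fun ω => h ω * s ω) (M.Z .dist1 i) μ := by
    have h1 : IndepFun ((fun t => f t * √(F0 (t.1 i))) ∘ M.sources (i + 1))
        ((fun z : Fin (i + 1) → ℝ => z (Fin.last i)) ∘ M.noise1 (i + 1)) μ :=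
      (hM.indepFun_sources_noise1 (i + 1)).comp (mf.mul (by fun_prop)) (by fun_prop)
    have h2 : (fun ω => h ω * s ω) =
        (fun t => f t * √(F0 (t.1 i))) ∘ M.sources (i + 1) := by
      funext ω
      simp only [hfh ω, Function.comp_apply]
      rfl
    rw [h2]
    exact h1
  have memZ : MemLp (M.Z .dist1 i) 2 μ :=
    (memLp_two_iff_integrable_sq mZ.aestronglyMeasurable).2
      (integrable_sq_gaussian mZ (hM.law_Z _ i))
  have icross : Integrable (fun ω => h ω * s ω * M.Z .dist1 i ω) μ :=
    hind.integrable_mul ihs (memZ.integrable one_le_two)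
  have hZ0 : ∫ ω, M.Z .dist1 i ω ∂μ = 0 := by
    have h1 := integral_map mZ.aemeasurable (f := fun x : ℝ => x) (μ := μ) (by fun_prop)
    rw [hM.law_Z, integral_id_gaussianReal] at h1
    exact h1.symm
  have hcross : ∫ ω, h ω * s ω * M.Z .dist1 i ω ∂μ = 0 := by
    rw [hind.integral_fun_mul_eq_mul_integral (mh.mul ms).aestronglyMeasurable
      mZ.aestronglyMeasurable, hZ0, mul_zero]
  have hexp : (fun ω => (M.dhat1 P i ω - M.estimate P i ω) ^ 2) =ᵐ[μ] fun ω =>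
      h ω ^ 2 + 2 * (h ω * s ω * M.Z .dist1 i ω) + F0 (M.state i ω) * M.Z .dist1 i ω ^ 2 := by
    filter_upwards [hs2] with ω hω
    have h1 : M.dhat1 P i ω - M.estimate P i ω = h ω + s ω * M.Z .dist1 i ω := by
      have : M.dhat1 P i ω = M.d12 i ω + s ω * M.Z .dist1 i ω := rfl
      rw [this, hh]
      ring
    rw [h1, ← hω]
    ring
  have i12 : Integrable (fun ω => h ω ^ 2 + 2 * (h ω * s ω * M.Z .dist1 i ω)) μ :=
    ih2.add (icross.const_mul 2)
  refine ⟨(i12.add iZ0).congr hexp.symm, ?_⟩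
  have hval : ∫ ω, (M.dhat1 P i ω - M.estimate P i ω) ^ 2 ∂μ =
      ∫ ω, h ω ^ 2 ∂μ + ∫ ω, F0 (M.state i ω) ∂μ := by
    rw [integral_congr_ae hexp, integral_add i12 iZ0, integral_add ih2 (icross.const_mul 2),
      integral_const_mul, hcross, hM.integral_mul_sq_noise mF0]
    ring
  have hbd : ∫ ω, h ω ^ 2 ∂μ ≤ 3 * (∫ ω, F1 (M.state i ω) ∂μ + ∫ ω, F2 (M.state i ω) ∂μ +
      ∫ ω, F3 (M.state i ω) ∂μ) := by
    refine (integral_mono_ae ih2 ibd hh2).trans (le_of_eq ?_)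
    rw [integral_const_mul, integral_add iZ12 iZ3, integral_add iZ1 iZ2,
      hM.integral_mul_sq_noise mF1, hM.integral_mul_sq_noise mF2, hM.integral_mul_sq_noise mF3]
  have hlast : ∫ ω, F0 (M.state i ω) ∂μ + 3 * (∫ ω, F1 (M.state i ω) ∂μ +
      ∫ ω, F2 (M.state i ω) ∂μ + ∫ ω, F3 (M.state i ω) ∂μ) ≤
      (∫ ω, M.stateErr (M.state i ω) ∂μ) / P := by
    have iF12 : Integrable (fun ω => F1 (M.state i ω) + F2 (M.state i ω)) μ := iF1.add iF2
    have iF123 : Integrable (fun ω =>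
        3 * (F1 (M.state i ω) + F2 (M.state i ω) + F3 (M.state i ω))) μ :=
      (iF12.add iF3).const_mul 3
    rw [← integral_add iF1 iF2, ← integral_add iF12 iF3, ← integral_const_mul,
      ← integral_add iF0 iF123, ← integral_div]
    refine integral_mono_ae (iF0.add iF123)
      ((hM.integrable_stateErr i).div_const P) ?_
    filter_upwards [hM.ae_admissible i] with ω hω using hle _ hω
  rw [hval]
  simp only [etaInner_eq]
  rw [← hM.integral_comp_state hM.measurable_stateErr i]
  linarith

/-- The clamping gives positivity at every triple of locations, as the channel bound requires, while
changing the scale only on a null set. -/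
lemma noiseScale_pos [IsProbabilityMeasure μ] (hM : M.IsGaussian μ) {P : ℝ} (hP : 0 < P)
    (q : Plane × Plane × Plane) : 0 < M.noiseScale P q := by
  have h := hM.γ_pos (max M.dMin (min (dist q.1 q.2.1) M.dMax))
    ⟨le_max_left _ _, max_le hM.dMin_le_dMax (min_le_right _ _)⟩
  have := hM.ρ1_pos
  exact Real.sqrt_pos.2 (by positivity)

/-- Isolates the dependence on P; the factor 2π is inserted in both logarithms to match `etaLog`. -/
lemma log_noiseScale (hM : M.IsGaussian μ) {P : ℝ} (hP : 0 < P) (i : ℕ) :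
    (fun ω => Real.log (M.noiseScale P (M.state i ω))) =ᵐ[μ] fun ω =>
      1 / 2 * (Real.log (2 * Real.pi * M.ρ1 * M.γ (dist (M.state i ω).1 (M.state i ω).2.1)) -
        Real.log (2 * Real.pi * P)) := by
  filter_upwards [hM.ae_admissible i] with ω hω
  have h1 := hM.γ_pos _ hω.1
  have h2 := hM.ρ1_pos
  rw [noiseScale_eq P hω, Real.log_sqrt (by positivity), ← Real.log_div (by positivity)
    (by positivity)]
  have : M.γ (dist (M.state i ω).1 (M.state i ω).2.1) * M.ρ1 / P =
      2 * Real.pi * M.ρ1 * M.γ (dist (M.state i ω).1 (M.state i ω).2.1) / (2 * Real.pi * P) := by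
    field_simp
  rw [this]
  ring

lemma integrable_log_noiseScale [IsProbabilityMeasure μ] (hM : M.IsGaussian μ) {P : ℝ}
    (hP : 0 < P) (i : ℕ) :
    Integrable (fun ω => Real.log (M.noiseScale P (M.state i ω))) μ ∧
    ∫ ω, Real.log (M.noiseScale P (M.state i ω)) ∂μ =
      1 / 2 * (∫ ω, M.etaLog ω ∂μ - Real.log (2 * Real.pi * P)) := by
  have hγ := hM.meas_γ
  have hL : Measurable (fun q : Plane × Plane × Plane =>
    Real.log (2 * Real.pi * M.ρ1 * M.γ (dist q.1 q.2.1))) := by fun_prop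
  have h1 : Integrable (fun ω =>
      Real.log (2 * Real.pi * M.ρ1 * M.γ (dist (M.state i ω).1 (M.state i ω).2.1))) μ := by
    have h2 : Integrable ((fun q : Plane × Plane × Plane =>
      Real.log (2 * Real.pi * M.ρ1 * M.γ (dist q.1 q.2.1))) ∘ M.state 0) μ := hM.integrable_etaLog
    rw [← integrable_map_measure hL.aestronglyMeasurable (hM.measurable_state 0).aemeasurable,
      ← hM.stationary i,
      integrable_map_measure hL.aestronglyMeasurable (hM.measurable_state i).aemeasurable] at h2
    exact h2
  refine ⟨((h1.sub (integrable_const _)).const_mul _).congr (hM.log_noiseScale hP i).symm, ?_⟩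
  rw [integral_congr_ae (hM.log_noiseScale hP i), integral_const_mul,
    integral_sub h1 (integrable_const _), hM.integral_comp_state hL i]
  simp only [integral_const, probReal_univ, one_smul]
  rfl

/-- The bound holds at every power and every number of slots. -/
lemma condMutualInfo_le_mul_eta [IsProbabilityMeasure μ] (hM : M.IsGaussian μ)
    (hobs : M.observesAngle = true) {P : ℝ} (hP : 0 < P) (n : ℕ) :
    0 ≤ n * M.eta μ ∧
    condMutualInfo μ (M.obs1 P n) (M.obs2 P n) (M.obsE P n) ≤ ENNReal.ofReal (n * M.eta μ) := by
  have hK := hM.integral_etaInner_pos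
  -- σ² is the mean square error bound, the same in every slot.
  have hσ : 0 < √((∫ ω, M.etaInner ω ∂μ) / P) := Real.sqrt_pos.2 (by positivity)
  have hscale := hM.measurable_noiseScale P
  have h := condMutualInfo_le_of_gaussian_noise μ (T := M.sources n) (X := M.obs1 P n)
    (N := M.noise1 n) (Y := M.obs2 P n) (Z := M.obsE P n)
    (f := M.obs2Of P n) (g := M.obsEOf P n)
    (hM.measurable_sources n) (hM.measurable_noise1 n) (hM.measurable_obs1 P n)
    (hM.measurable_obs2Of P n) (hM.measurable_obsEOf P n) (fun ω => rfl)
    (obsE_eq_obsEOf hobs P n) (hM.indepFun_sources_noise1 n) (hM.map_noise1 n)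
    (m := fun i t => dist (t.1 i).1 (t.1 i).2.1) (s := fun i t => M.noiseScale P (t.1 i))
    (fun i => by fun_prop) (fun i => by fun_prop) (fun i t => hM.noiseScale_pos hP _)
    (by
      rw [ae_all_iff]
      intro i
      filter_upwards [hM.ae_admissible i] with ω hω
      have h1 := noiseScale_eq P hω
      simp only [sources]
      rw [h1]
      rfl)
    (fun i => (hM.integrable_log_noiseScale hP i).1)
    (e := fun i z => thirdSide (z i).1 (z i).2.1 (z i).2.2) (fun i => by fun_prop) hσ
    (fun i => (hM.integral_sq_dhat1_sub_estimate_le hobs hP i).1)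
    (fun i => by
      rw [Real.sq_sqrt (by positivity)]
      exact (hM.integral_sq_dhat1_sub_estimate_le hobs hP i).2)
  have hsum : ∑ i : Fin n, (Real.log √((∫ ω, M.etaInner ω ∂μ) / P) -
      ∫ ω, Real.log (M.noiseScale P ((M.sources n ω).1 i)) ∂μ) = n * M.eta μ := by
    have hi (i : Fin n) : Real.log √((∫ ω, M.etaInner ω ∂μ) / P) -
        ∫ ω, Real.log (M.noiseScale P ((M.sources n ω).1 i)) ∂μ = M.eta μ := by
      have h1 := (hM.integrable_log_noiseScale hP i).2
      simp only [sources]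
      -- Both σ² and the noise variance carry the factor 1/P, so log P cancels and the bound per
      -- slot is exactly η.
      rw [h1, eta, Real.log_sqrt (by positivity), Real.log_div hK.ne' hP.ne',
        Real.log_mul (by positivity) hP.ne', Real.log_mul (by positivity) hK.ne']
      ring
    simp [hi]
  rw [hsum] at h
  exact h

/-- η does not depend on P or n, so the nonnegative divergence bound for one slot at unit power
already decides its sign. -/
lemma eta_nonneg [IsProbabilityMeasure μ] (hM : M.IsGaussian μ)
    (hobs : M.observesAngle = true) : 0 ≤ M.eta μ := by
  simpa using (hM.condMutualInfo_le_mul_eta hobs one_pos 1).1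

lemma RU_le_eta [IsProbabilityMeasure μ] (hM : M.IsGaussian μ)
    (hobs : M.observesAngle = true) {P : ℝ} (hP : 0 < P) :
    M.RU μ P ≤ ENNReal.ofReal (M.eta μ) := by
  refine limsup_le_of_le (by isBoundedDefault) ?_
  filter_upwards [eventually_gt_atTop 0] with n hn
  refine ENNReal.div_le_of_le_mul ?_
  refine (min_le_right _ _).trans ((hM.condMutualInfo_le_mul_eta hobs hP n).2.trans ?_)
  rw [mul_comm, ENNReal.ofReal_mul (hM.eta_nonneg hobs), ENNReal.ofReal_natCast]

end IsGaussian

end KeyGen.Model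

theorem theorem2 {Ω : Type*} [MeasurableSpace Ω] (μ : Measure Ω) [IsProbabilityMeasure μ]
    (M : KeyGen.Model Ω) (hM : M.IsGaussian μ)
    (hangle : ∃ P : ℝ, 0 < P ∧ ∃ n : ℕ,
      0 < KeyGen.mutualInfo μ (M.phihatVec P n) (M.phiVec n)) :
    limsup (fun P : ℝ => M.RU μ P) atTop < ∞ ∧
    Integrable M.etaInner μ ∧ 0 < ∫ ω, M.etaInner ω ∂μ ∧ Integrable M.etaLog μ ∧
    limsup (fun P : ℝ => (M.RU μ P : EReal)) atTop ≤ ((M.eta μ : ℝ) : EReal) := by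
  obtain ⟨_, -, _, hpos⟩ := hangle
  have hobs := hM.observesAngle_of_mutualInfo_pos hpos
  refine ⟨?_, hM.integrable_stateErr 0, hM.integral_etaInner_pos, hM.integrable_etaLog, ?_⟩
  · refine lt_of_le_of_lt (limsup_le_of_le (by isBoundedDefault) ?_)
      (ENNReal.ofReal_lt_top (r := M.eta μ))
    filter_upwards [eventually_gt_atTop 0] with P hP using hM.RU_le_eta hobs hP
  · refine limsup_le_of_le (by isBoundedDefault) ?_
    filter_upwards [eventually_gt_atTop 0] with P hP
    have h := EReal.coe_ennreal_le_coe_ennreal_iff.2 (hM.RU_le_eta hobs hP)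
    -- As η is nonnegative, its truncation to `ℝ≥0∞` and its value in `EReal` agree.
    rwa [EReal.coe_ennreal_ofReal, max_eq_left (hM.eta_nonneg hobs)] at h
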